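/- Let $G=S_3$ and let $R$ be a commutative ring. A finite $(G,G)$-biset is a finite set with commuting left and right $G$-actions. The double Burnside algebra $B_R=B_R(S_3,S_3)$ is the free $R$-module on the isomorphism classes of finite $(S_3,S_3)$-bisets modulo the relations $[M\sqcup N]=[M]+[N]$, with multiplication $[M][N]=[M\times_{S_3}N]$, where $M\times_{S_3}N$ is the set of orbits of $S_3$ on $M\times N$ under $g(m,n)=(mg^{-1},gn)$; the unit is $[S_3]$. For $U\le S_3\times S_3$ regard $(S_3\times S_3)/U$ as a biset via $h\cdot x\cdot p=(h,p^{-1})x$. Put $a=(1,2)$, $b=(1,2,3)$, $V_0=1$, $V_1=\langle a\rangle$, $V_4=\langle b\rangle$, $V_5=S_3$, and let $H_{i,j}=[(S_3\times S_3)/(V_i\times V_j)]$, while $H_1^\Delta,H_4^\Delta,H_5^\Delta,H_6,H_7,H_8$ are the classes of $(S_3\times S_3)/U$ for $U=\langle(a,a)\rangle$, $\langle(b,b)\rangle$, $\langle(a,a),(b,b)\rangle$, $\langle(a,a),(1,b)\rangle$, $\langle(a,a),(b,1)\rangle$, $\langle(a,a),(b,1),(1,b)\rangle$, respectively. For a commutative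 ring $S$ let $S[\bar\eta,\bar\xi]=S[\eta,\xi]/(\eta^2,\eta\xi,\xi^2)$ and let $$A_S=\begin{bmatrix}S^{3\times3}&0&0&S^{3\times1}\\0&S&0&S\\0&0&S&0\\S^{1\times3}&S&0&S[\bar\eta,\bar\xi]\end{bmatrix},\qquad\text{with elements}\quad\begin{bmatrix}s&0&0&t\\0&u&0&v\\0&0&w&0\\x&y&0&z_1+z_2\bar\eta+z_3\bar\xi\end{bmatrix},$$ with componentwise addition and block multiplication, where the products of blocks are the usual ones except that $\bar\eta,\bar\xi$ act as $0$ on the off-diagonal blocks, the products of the $(1,4)$ with the $(4,1)$ entry and of the $(2,4)$ with the $(4,2)$ entry are $0$, the product of $x$ in position $(4,1)$ with $t$ in position $(1,4)$ is $xt\,\bar\eta$, and the product of $y$ in position $(4,2)$ with $v$ in position $(2,4)$ is $yv(\bar\xi-12\bar\eta)$. Also products into the positions $(1,2)$ and $(2,1)$ are $0$. Write $A=A_{\mathbf Q}$, and regard $A_{\mathbf Z_{(2)}}\subseteq A$. In $B_{\mathbf Q}$ put $$\begin{aligned} e&=-\tfrac12H_{0,0}+H_{1,0}+\tfrac12H_{4,0},\\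 b_{e,g}&=\tfrac12H_{0,0}-H_{1,0}-\tfrac12H_{0,1}-\tfrac12H_{4,0}+H_{1,1}+\tfrac12H_{4,1},\\ b_{e,h}&=-\tfrac18H_{0,0}+\tfrac14H_{1,0}+\tfrac12H_{0,1}+\tfrac18H_{4,0}-\tfrac38H_{0,4}-H_{1,1}-\tfrac12H_{4,1}+\tfrac34H_{1,4}+\tfrac38H_{4,4},\\ b_{g,e}&=-\tfrac43H_{0,0}+2H_{1,0}+H_{4,0},\\ g&=\tfrac43H_{0,0}-2H_{1,0}-\tfrac43H_{0,1}-H_{4,0}+2H_{1,1}+H_{4,1},\\ b_{g,h}&=-\tfrac13H_{0,0}+\tfrac12H_{1,0}+\tfrac43H_{0,1}+\tfrac14H_{4,0}-H_{0,4}-2H_{1,1}-H_{4,1}+\tfrac32H_{1,4}+\tfrac34H_{4,4},\\ b_{h,e}&=-\tfrac13H_{0,0}+H_{4,0},\\ b_{h,g}&=\tfrac13H_{0,0}-\tfrac13H_{0,1}-H_{4,0}+H_{4,1},\\ h&=-\tfrac1{12}H_{0,0}+\tfrac13H_{0,1}+\tfrac14H_{4,0}-\tfrac14H_{0,4}+\tfrac34H_{4,4}-H_{4,1},\\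 b_{e,4}&=-\tfrac18H_{0,0}+\tfrac14H_{1,0}+\tfrac14H_{0,1}+\tfrac18H_{4,0}+\tfrac18H_{0,4}-\tfrac12H_{1,1}-\tfrac14H_{0,5}-\tfrac14H_{4,1}-\tfrac14H_{1,4}-\tfrac18H_{4,4}+\tfrac12H_{1,5}+\tfrac14H_{4,5},\\ b_{g,4}&=-\tfrac13H_{0,0}+\tfrac12H_{1,0}+\tfrac23H_{0,1}+\tfrac14H_{4,0}+\tfrac13H_{0,4}-H_{1,1}-\tfrac23H_{0,5}-\tfrac12H_{4,1}-\tfrac12H_{1,4}-\tfrac14H_{4,4}+H_{1,5}+\tfrac12H_{4,5},\\ b_{h,4}&=-\tfrac1{12}H_{0,0}+\tfrac16H_{0,1}+\tfrac14H_{4,0}+\tfrac1{12}H_{0,4}-\tfrac16H_{0,5}-\tfrac12H_{4,1}-\tfrac14H_{4,4}+\tfrac12H_{4,5},\\ \varepsilon_2&=-H_{0,0}+H_{1,0}+H_{0,1}+H^\Delta_1-2H_{1,1},\\ b_{2,4}&=-\tfrac12H_{0,0}+\tfrac12H_{1,0}+\tfrac12H_{0,1}+\tfrac12H^\Delta_1+\tfrac12H_{0,4}-H_{1,1}-\tfrac12H_{0,5}-\tfrac12H_6-\tfrac12H_{1,4}+H_{1,5},\\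 \varepsilon_3&=-\tfrac14H_{0,0}+\tfrac14H_{4,0}+\tfrac14H_{0,4}+\tfrac12H^\Delta_4-\tfrac34H_{4,4},\\ b_{4,e}&=\tfrac16H_{0,0}-\tfrac13H_{1,0}-\tfrac16H_{4,0}+\tfrac13H_{5,0},\\ b_{4,g}&=-\tfrac16H_{0,0}+\tfrac13H_{1,0}+\tfrac16H_{0,1}+\tfrac16H_{4,0}-\tfrac13H_{1,1}-\tfrac13H_{5,0}-\tfrac16H_{4,1}+\tfrac13H_{5,1},\\ b_{4,h}&=\tfrac1{24}H_{0,0}-\tfrac1{12}H_{1,0}-\tfrac16H_{0,1}-\tfrac1{24}H_{4,0}+\tfrac18H_{0,4}+\tfrac13H_{1,1}+\tfrac1{12}H_{5,0}+\tfrac16H_{4,1}-\tfrac14H_{1,4}-\tfrac18H_{4,4}-\tfrac13H_{5,1}+\tfrac14H_{5,4},\\ b_{4,2}&=-\tfrac12H_{0,0}+\tfrac12H_{1,0}+\tfrac12H_{0,1}+\tfrac12H^\Delta_1+\tfrac12H_{4,0}-H_{1,1}-\tfrac12H_{5,0}-\tfrac12H_{4,1}-\tfrac12H_7+H_{5,1},\\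 \varepsilon_4&=\tfrac12H_{0,0}-H^\Delta_1-\tfrac12H^\Delta_4+H^\Delta_5,\\ b'&=\tfrac1{24}H_{0,0}-\tfrac1{12}H_{1,0}-\tfrac1{12}H_{0,1}-\tfrac1{24}H_{4,0}-\tfrac1{24}H_{0,4}+\tfrac16H_{1,1}+\tfrac1{12}H_{5,0}+\tfrac1{12}H_{0,5}+\tfrac1{12}H_{4,1}+\tfrac1{12}H_{1,4}+\tfrac1{24}H_{4,4}\\&\quad-\tfrac16H_{1,5}-\tfrac16H_{5,1}-\tfrac1{12}H_{4,5}-\tfrac1{12}H_{5,4}+\tfrac16H_{5,5},\\ b''&=\tfrac14H_{0,0}-\tfrac34H_{1,0}-\tfrac34H_{0,1}+\tfrac14H^\Delta_1-\tfrac14H_{4,0}-\tfrac14H_{0,4}+\tfrac32H_{1,1}+\tfrac34H_{5,0}+\tfrac34H_{0,5}-\tfrac14H_6+\tfrac34H_{4,1}+\tfrac34H_{1,4}-\tfrac14H_7+\tfrac14H_{4,4}\\&\quad-\tfrac32H_{1,5}-\tfrac32H_{5,1}-\tfrac34H_{4,5}-\tfrac34H_{5,4}+\tfrac14H_8+\tfrac32H_{5,5}.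 \end{aligned}$$ Let $\gamma:A\to B_{\mathbf Q}$ be the $\mathbf Q$-linear map sending the element displayed above to $$\begin{aligned}&s_{1,1}e+s_{1,2}b_{e,g}+s_{1,3}b_{e,h}+s_{2,1}b_{g,e}+s_{2,2}g+s_{2,3}b_{g,h}+s_{3,1}b_{h,e}+s_{3,2}b_{h,g}+s_{3,3}h+t_1b_{e,4}+t_2b_{g,4}+t_3b_{h,4}\\&+u\varepsilon_2+vb_{2,4}+w\varepsilon_3+x_1b_{4,e}+x_2b_{4,g}+x_3b_{4,h}+yb_{4,2}+z_1\varepsilon_4+z_2b'+z_3b''.\end{aligned}$$ Let $X_1,X_2,X_3\in A^\times$ be as follows: $X_1$ and $X_2$ differ from $1_A$ only in the block $s$, which is $\begin{pmatrix}0&-2&0\\6&6&-4\\0&0&1\end{pmatrix}$ and $\begin{pmatrix}1&0&0\\0&1&0\\0&7&1\end{pmatrix}$, respectively; $X_3$ differs from $1_A$ only in $t_3=1$ and $x_3=6$. Then $\gamma$ is an isomorphism of $\mathbf Q$-algebras. Let $\delta:B_{\mathbf Z}\to A$, $\delta(\beta)=X_3^{-1}X_2^{-1}X_1^{-1}\,\gamma^{-1}(\beta)\,X_1X_2X_3$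 (where $\gamma^{-1}$ is applied to the image of $\beta$ in $B_{\mathbf Q}$), let $\Lambda=\delta(B_{\mathbf Z})$, and let $\Lambda_{(2)}$ be its localisation at $2$, i.e. the $\mathbf Z_{(2)}$-linear span of $\Lambda$ in $A$. Then $$\Lambda_{(2)}=\left\{\begin{bmatrix}s&0&0&t\\0&u&0&v\\0&0&w&0\\x&y&0&z_1+z_2\bar\eta+z_3\bar\xi\end{bmatrix}\in A_{\mathbf Z_{(2)}}:\ \begin{array}{l}2w-2z_1\equiv_8z_2\equiv_4z_3\equiv_40,\\x_i\equiv_40\ (i=1,2,3),\quad y\equiv_20,\\t_i\equiv_20\ (i=1,2,3),\quad v\equiv_20\end{array}\right\}\subseteq A_{\mathbf Z_{(2)}},$$ where $\equiv_n$ denotes congruence modulo $n\mathbf Z_{(2)}$. In particular, $B_{\mathbf Z_{(2)}}(S_3,S_3)\cong\Lambda_{(2)}$ as $\mathbf Z_{(2)}$-algebras. -/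

import Mathlib

/-! ## Finite bisets and the double Burnside algebra -/

namespace DBurnside

open MulOpposite (op)

/-- A finite `(G,G)`-biset: a finite set with a left and a right `G`-action that commute.
The right action `x · g` is written `op g • x`. -/
structure Biset (G : Type) [Group G] where
  carrier : Type
  [finite : Finite carrier]
  [left : MulAction G carrier]
  [right : MulAction Gᵐᵒᵖ carrier]
  [comm : SMulCommClass G Gᵐᵒᵖ carrier]

attribute [instance] Biset.finite Biset.left Biset.right Biset.comm

namespace Biset

variable {G : Type} [Group G]

/-- Isomorphisms of bisets. -/
structure Iso (M N : Biset G) extends M.carrier ≃ N.carrier where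
  map_left : ∀ (g : G) (m : M.carrier), toFun (g • m) = g • toFun m
  map_right : ∀ (g : G) (m : M.carrier), toFun (op g • m) = op g • toFun m

def Iso.refl (M : Biset G) : Iso M M := ⟨Equiv.refl _, fun _ _ => rfl, fun _ _ => rfl⟩

def Iso.symm {M N : Biset G} (f : Iso M N) : Iso N M where
  toEquiv := f.toEquiv.symm
  map_left g n := by
    apply f.toEquiv.injective
    have := f.map_left g (f.toEquiv.symm n)
    simp_all
  map_right g n := by
    apply f.toEquiv.injective
    have := f.map_right g (f.toEquiv.symm n)
    simp_all

def Iso.trans {M N L : Biset G} (f : Iso M N) (k : Iso N L) : Iso M L where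
  toEquiv := f.toEquiv.trans k.toEquiv
  map_left g m := by
    have h1 := f.map_left g m
    have h2 := k.map_left g (f.toEquiv m)
    simp_all
  map_right g m := by
    have h1 := f.map_right g m
    have h2 := k.map_right g (f.toEquiv m)
    simp_all

/-- The disjoint union of two bisets. -/
def disjUnion (M N : Biset G) : Biset G where
  carrier := M.carrier ⊕ N.carrier

/-- The `G`-orbit relation on `M × N` for the action `g (m, n) = (m g⁻¹, g n)`. -/
def tensorSetoid (M N : Biset G) : Setoid (M.carrier × N.carrier) where
  r p q := ∃ g : G, q = (op g⁻¹ • p.1, g • p.2)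
  iseqv :=
    { refl := fun p => ⟨1, by simp⟩
      symm := by
        rintro p q ⟨g, rfl⟩
        exact ⟨g⁻¹, by simp [smul_smul]⟩
      trans := by
        rintro p q r ⟨g, rfl⟩ ⟨h, rfl⟩
        exact ⟨h * g, by simp [smul_smul]⟩ }

/-- The underlying set of the tensor product `M ×_G N`. -/
def TensorSet (M N : Biset G) : Type := Quotient (tensorSetoid M N)

/-- The orbit `m ×_G n`. -/
def tmk {M N : Biset G} (m : M.carrier) (n : N.carrier) : TensorSet M N :=
  Quotient.mk (tensorSetoid M N) (m, n)

theorem tmk_surj {M N : Biset G} (x : TensorSet M N) : ∃ m n, x = tmk m n := by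
  induction x using Quotient.inductionOn with
  | _ p => exact ⟨p.1, p.2, rfl⟩

theorem tmk_rel {M N : Biset G} (m : M.carrier) (n : N.carrier) (g : G) :
    (tmk (op g • m) n : TensorSet M N) = tmk m (g • n) :=
  Quotient.sound ⟨g, by simp [smul_smul]⟩

/-- Maps out of the tensor product. -/
def tlift {M N : Biset G} {X : Type} (f : M.carrier → N.carrier → X)
    (hf : ∀ m n (g : G), f (op g • m) n = f m (g • n)) : TensorSet M N → X :=
  Quotient.lift (fun p => f p.1 p.2) (by
    rintro ⟨m, n⟩ _ ⟨g, rfl⟩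
    have := hf (op g⁻¹ • m) n g
    simpa [smul_smul] using this)

@[simp] theorem tlift_tmk {M N : Biset G} {X : Type} (f : M.carrier → N.carrier → X)
    (hf : ∀ m n (g : G), f (op g • m) n = f m (g • n)) (m : M.carrier) (n : N.carrier) :
    tlift f hf (tmk m n) = f m n := rfl

instance (M N : Biset G) : Finite (TensorSet M N) :=
  inferInstanceAs (Finite (Quotient (tensorSetoid M N)))

instance (M N : Biset G) : MulAction G (TensorSet M N) where
  smul h := tlift (fun m n => tmk (h • m) n) (fun m n g => by
    rw [← tmk_rel, smul_comm])
  one_smul x := by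
    obtain ⟨m, n, rfl⟩ := tmk_surj x
    change tmk _ _ = _
    rw [one_smul]
  mul_smul h k x := by
    obtain ⟨m, n, rfl⟩ := tmk_surj x
    change tmk _ _ = tmk _ _
    rw [mul_smul]

instance (M N : Biset G) : MulAction Gᵐᵒᵖ (TensorSet M N) where
  smul h := tlift (fun m n => tmk m (h • n)) (fun m n g => by
    rw [tmk_rel, smul_comm])
  one_smul x := by
    obtain ⟨m, n, rfl⟩ := tmk_surj x
    change tmk _ _ = _
    rw [one_smul]
  mul_smul h k x := by
    obtain ⟨m, n, rfl⟩ := tmk_surj x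
    change tmk _ _ = tmk _ _
    rw [mul_smul]

@[simp] theorem smul_tmk {M N : Biset G} (h : G) (m : M.carrier) (n : N.carrier) :
    h • (tmk m n : TensorSet M N) = tmk (h • m) n := rfl

@[simp] theorem op_smul_tmk {M N : Biset G} (h : Gᵐᵒᵖ) (m : M.carrier) (n : N.carrier) :
    h • (tmk m n : TensorSet M N) = tmk m (h • n) := rfl

instance (M N : Biset G) : SMulCommClass G Gᵐᵒᵖ (TensorSet M N) where
  smul_comm h k x := by
    obtain ⟨m, n, rfl⟩ := tmk_surj x
    rfl

/-- The tensor product `M ×_G N` of bisets: the set of `G`-orbits on `M × N`,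
with `h (m ×_G n) p = (h m) ×_G (n p)`. -/
def tensor (M N : Biset G) : Biset G where
  carrier := TensorSet M N

/-- `G` as a biset via multiplication. -/
def unit (G : Type) [Group G] [Finite G] : Biset G where
  carrier := G

/-- The biset `(G × G) / U`, with `h · x · p = (h, p⁻¹) x`. -/
def ofSubgroup [Finite G] (U : Subgroup (G × G)) : Biset G :=
  letI : MulAction G ((G × G) ⧸ U) := MulAction.compHom _ (MonoidHom.inl G G)
  letI : MulAction Gᵐᵒᵖ ((G × G) ⧸ U) :=
    MulAction.compHom _ ((MonoidHom.inr G G).comp (MulEquiv.inv' G).symm.toMonoidHom)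
  { carrier := (G × G) ⧸ U
    comm := ⟨fun h k x => by
      change (h, (1 : G)) • ((1 : G), (MulOpposite.unop k)⁻¹) • x =
        ((1 : G), (MulOpposite.unop k)⁻¹) • (h, (1 : G)) • x
      simp [smul_smul]⟩ }

theorem ofSubgroup_smul [Finite G] (U : Subgroup (G × G)) (h a b : G) :
    h • (show (ofSubgroup U).carrier from (((a, b) : G × G) : (G × G) ⧸ U)) =
      (((h * a, b) : G × G) : (G × G) ⧸ U) := by
  change (h, (1 : G)) • (((a, b) : G × G) : (G × G) ⧸ U) = _
  rw [MulAction.Quotient.smul_coe]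
  simp

theorem ofSubgroup_op_smul [Finite G] (U : Subgroup (G × G)) (p a b : G) :
    op p • (show (ofSubgroup U).carrier from (((a, b) : G × G) : (G × G) ⧸ U)) =
      (((a, p⁻¹ * b) : G × G) : (G × G) ⧸ U) := by
  change ((1 : G), p⁻¹) • (((a, b) : G × G) : (G × G) ⧸ U) = _
  rw [MulAction.Quotient.smul_coe]
  simp

def tensorCongr {M M' N N' : Biset G} (f : Iso M M') (k : Iso N N') :
    Iso (tensor M N) (tensor M' N') where
  toFun := tlift (fun m n => tmk (f.toEquiv m) (k.toEquiv n)) (fun m n g => by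
    have h1 := f.map_right g m
    have h2 := k.map_left g n
    simp only [Equiv.toFun_as_coe] at h1 h2
    rw [h1, h2, tmk_rel])
  invFun := tlift (fun m n => tmk (f.symm.toEquiv m) (k.symm.toEquiv n)) (fun m n g => by
    have h1 := f.symm.map_right g m
    have h2 := k.symm.map_left g n
    simp only [Equiv.toFun_as_coe] at h1 h2
    rw [h1, h2, tmk_rel])
  left_inv x := by
    obtain ⟨m, n, rfl⟩ := tmk_surj x
    exact congrArg₂ tmk (f.toEquiv.symm_apply_apply m) (k.toEquiv.symm_apply_apply n)
  right_inv x := by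
    obtain ⟨m, n, rfl⟩ := tmk_surj x
    exact congrArg₂ tmk (f.toEquiv.apply_symm_apply m) (k.toEquiv.apply_symm_apply n)
  map_left g x := by
    obtain ⟨m, n, rfl⟩ := tmk_surj x
    exact congrArg (fun z => tmk z _) (f.map_left g m)
  map_right g x := by
    obtain ⟨m, n, rfl⟩ := tmk_surj x
    exact congrArg (fun z => tmk _ z) (k.map_right g n)

def disjUnionCongr {M M' N N' : Biset G} (f : Iso M M') (k : Iso N N') :
    Iso (disjUnion M N) (disjUnion M' N') where
  toEquiv := Equiv.sumCongr f.toEquiv k.toEquiv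
  map_left g x := by
    rcases x with m | n
    · exact congrArg Sum.inl (f.map_left g m)
    · exact congrArg Sum.inr (k.map_left g n)
  map_right g x := by
    rcases x with m | n
    · exact congrArg Sum.inl (f.map_right g m)
    · exact congrArg Sum.inr (k.map_right g n)

def tensorAssoc (M N L : Biset G) :
    Iso (tensor (tensor M N) L) (tensor M (tensor N L)) where
  toFun := tlift (N := L) (M := tensor M N)
    (fun x l => tlift (fun m n => (tmk m (tmk n l : TensorSet N L) : TensorSet M (tensor N L)))
      (fun m n g => tmk_rel (N := tensor N L) m (tmk n l) g) x)
    (fun x l g => by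
      obtain ⟨m, n, rfl⟩ := tmk_surj (M := M) (N := N) x
      exact congrArg (fun z => (tmk m z : TensorSet M (tensor N L))) (tmk_rel n l g))
  invFun := tlift (N := tensor N L) (M := M)
    (fun m x => tlift (fun n l => (tmk (tmk m n : TensorSet M N) l : TensorSet (tensor M N) L))
      (fun n l g => tmk_rel (M := tensor M N) (tmk m n) l g) x)
    (fun m x g => by
      obtain ⟨n, l, rfl⟩ := tmk_surj (M := N) (N := L) x
      exact congrArg (fun z => (tmk z l : TensorSet (tensor M N) L)) (tmk_rel m n g))
  left_inv x := by
    obtain ⟨y, l, rfl⟩ := tmk_surj (M := tensor M N) (N := L) x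
    obtain ⟨m, n, rfl⟩ := tmk_surj (M := M) (N := N) y
    rfl
  right_inv x := by
    obtain ⟨m, y, rfl⟩ := tmk_surj (M := M) (N := tensor N L) x
    obtain ⟨n, l, rfl⟩ := tmk_surj (M := N) (N := L) y
    rfl
  map_left g x := by
    obtain ⟨y, l, rfl⟩ := tmk_surj (M := tensor M N) (N := L) x
    obtain ⟨m, n, rfl⟩ := tmk_surj (M := M) (N := N) y
    rfl
  map_right g x := by
    obtain ⟨y, l, rfl⟩ := tmk_surj (M := tensor M N) (N := L) x
    obtain ⟨m, n, rfl⟩ := tmk_surj (M := M) (N := N) y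
    rfl

def unitTensor [Finite G] (M : Biset G) : Iso (tensor (unit G) M) M where
  toFun := tlift (M := unit G) (fun (g : G) m => g • m) (fun (m : G) n g => mul_smul m g n)
  invFun m := tmk (M := unit G) (1 : G) m
  left_inv x := by
    obtain ⟨g, m, rfl⟩ := tmk_surj (M := unit G) x
    refine (tmk_rel (M := unit G) (1 : G) m g).symm.trans ?_
    exact congrArg (fun z => (tmk z m : TensorSet (unit G) M)) (one_mul (M := G) g)
  right_inv m := one_smul G m
  map_left g x := by
    obtain ⟨h, m, rfl⟩ := tmk_surj (M := unit G) x
    exact mul_smul g h m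
  map_right g x := by
    obtain ⟨h, m, rfl⟩ := tmk_surj (M := unit G) x
    exact smul_comm (M := G) h (op g) m

def tensorUnit [Finite G] (M : Biset G) : Iso (tensor M (unit G)) M where
  toFun := tlift (N := unit G) (fun m (g : G) => op g • m) (fun m (h : G) g => by
    change op h • op g • m = op (g * h) • m
    rw [smul_smul, MulOpposite.op_mul])
  invFun m := tmk (N := unit G) m (1 : G)
  left_inv x := by
    obtain ⟨m, g, rfl⟩ := tmk_surj (N := unit G) x
    refine (tmk_rel (N := unit G) m (1 : G) g).trans ?_
    exact congrArg (fun z => (tmk m z : TensorSet M (unit G))) (mul_one (M := G) g)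
  right_inv m := one_smul Gᵐᵒᵖ m
  map_left g x := by
    obtain ⟨m, h, rfl⟩ := tmk_surj (N := unit G) x
    exact (smul_comm g (op (α := G) h) m).symm
  map_right g x := by
    obtain ⟨m, h, rfl⟩ := tmk_surj (N := unit G) x
    exact mul_smul (op g) (op (α := G) h) m

def tensorDisjUnion (L M N : Biset G) :
    Iso (tensor L (disjUnion M N)) (disjUnion (tensor L M) (tensor L N)) where
  toFun := tlift (N := disjUnion M N)
    (fun l x => Sum.map (fun m => (tmk l m : TensorSet L M)) (fun n => (tmk l n : TensorSet L N)) x)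
    (fun l x g => by
      rcases x with m | n
      · exact congrArg Sum.inl (tmk_rel l m g)
      · exact congrArg Sum.inr (tmk_rel l n g))
  invFun := Sum.elim
    (tlift (fun l m => (tmk l (Sum.inl m) : TensorSet L (disjUnion M N)))
      (fun l m g => tmk_rel (N := disjUnion M N) l (Sum.inl m) g))
    (tlift (fun l n => (tmk l (Sum.inr n) : TensorSet L (disjUnion M N)))
      (fun l n g => tmk_rel (N := disjUnion M N) l (Sum.inr n) g))
  left_inv x := by
    obtain ⟨l, y, rfl⟩ := tmk_surj (N := disjUnion M N) x
    rcases y with m | n <;> rfl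
  right_inv x := by
    rcases x with x | x <;> obtain ⟨l, y, rfl⟩ := tmk_surj x <;> rfl
  map_left g x := by
    obtain ⟨l, y, rfl⟩ := tmk_surj (N := disjUnion M N) x
    rcases y with m | n <;> rfl
  map_right g x := by
    obtain ⟨l, y, rfl⟩ := tmk_surj (N := disjUnion M N) x
    rcases y with m | n <;> rfl

def disjUnionTensor (M N L : Biset G) :
    Iso (tensor (disjUnion M N) L) (disjUnion (tensor M L) (tensor N L)) where
  toFun := tlift (M := disjUnion M N)
    (fun x l => Sum.map (fun m => (tmk m l : TensorSet M L)) (fun n => (tmk n l : TensorSet N L)) x)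
    (fun x l g => by
      rcases x with m | n
      · exact congrArg Sum.inl (tmk_rel m l g)
      · exact congrArg Sum.inr (tmk_rel n l g))
  invFun := Sum.elim
    (tlift (fun m l => (tmk (Sum.inl m) l : TensorSet (disjUnion M N) L))
      (fun m l g => tmk_rel (M := disjUnion M N) (Sum.inl m) l g))
    (tlift (fun n l => (tmk (Sum.inr n) l : TensorSet (disjUnion M N) L))
      (fun n l g => tmk_rel (M := disjUnion M N) (Sum.inr n) l g))
  left_inv x := by
    obtain ⟨y, l, rfl⟩ := tmk_surj (M := disjUnion M N) x
    rcases y with m | n <;> rfl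
  right_inv x := by
    rcases x with x | x <;> obtain ⟨l, y, rfl⟩ := tmk_surj x <;> rfl
  map_left g x := by
    obtain ⟨y, l, rfl⟩ := tmk_surj (M := disjUnion M N) x
    rcases y with m | n <;> rfl
  map_right g x := by
    obtain ⟨y, l, rfl⟩ := tmk_surj (M := disjUnion M N) x
    rcases y with m | n <;> rfl

instance isoSetoid (G : Type) [Group G] : Setoid (Biset G) where
  r M N := Nonempty (Iso M N)
  iseqv := ⟨fun M => ⟨Iso.refl M⟩, fun ⟨f⟩ => ⟨f.symm⟩, fun ⟨f⟩ ⟨k⟩ => ⟨f.trans k⟩⟩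

end Biset

open Biset

/-- Isomorphism classes of finite `(G,G)`-bisets. -/
def BisetClass (G : Type) [Group G] : Type 1 := Quotient (Biset.isoSetoid G)

section

variable (G : Type) [Group G] [Finite G]

/-- The tensor product makes the isomorphism classes of bisets a monoid. -/
instance : Monoid (BisetClass G) where
  mul := Quotient.map₂ tensor (fun _ _ ⟨f⟩ _ _ ⟨k⟩ => ⟨tensorCongr f k⟩)
  one := Quotient.mk _ (unit G)
  mul_assoc x y z := by
    induction x, y using Quotient.inductionOn₂ with
    | _ M N =>
      induction z using Quotient.inductionOn with
      | _ L => exact Quotient.sound ⟨tensorAssoc M N L⟩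
  one_mul x := by
    induction x using Quotient.inductionOn with
    | _ M => exact Quotient.sound ⟨unitTensor M⟩
  mul_one x := by
    induction x using Quotient.inductionOn with
    | _ M => exact Quotient.sound ⟨tensorUnit M⟩

variable {G}

/-- The isomorphism class of a biset. -/
def isoClass (M : Biset G) : BisetClass G := Quotient.mk _ M

theorem isoClass_mul (M N : Biset G) :
    isoClass M * isoClass N = isoClass (tensor M N) := rfl

end

section

variable (R : Type) [CommRing R] (G : Type) [Group G] [Finite G]

/-- The free `R`-module on the isomorphism classes of finite `(G,G)`-bisets, with the
multiplication `[M] [N] = [M ×_G N]`. -/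
abbrev FreeBiset : Type 1 := MonoidAlgebra R (BisetClass G)

/-- The elements `[M ⊔ N] - [M] - [N]`. -/
def relators : Set (FreeBiset R G) :=
  {x | ∃ M N : Biset G, x = MonoidAlgebra.of R _ (isoClass (disjUnion M N))
    - MonoidAlgebra.of R _ (isoClass M) - MonoidAlgebra.of R _ (isoClass N)}

theorem mul_relator_mem (f x : FreeBiset R G) (hx : x ∈ Submodule.span R (relators R G)) :
    f * x ∈ Submodule.span R (relators R G) := by
  induction f using MonoidAlgebra.induction_on with
  | of c =>
    induction c using Quotient.inductionOn with
    | _ L =>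
      induction hx using Submodule.span_induction with
      | mem y hy =>
        obtain ⟨M, N, rfl⟩ := hy
        refine Submodule.subset_span ⟨tensor L M, tensor L N, ?_⟩
        have h : isoClass L * isoClass (disjUnion M N) =
            isoClass (disjUnion (tensor L M) (tensor L N)) :=
          Quotient.sound ⟨tensorDisjUnion L M N⟩
        change MonoidAlgebra.of R _ (isoClass L) * _ = _
        rw [mul_sub, mul_sub, ← map_mul, ← map_mul, ← map_mul, h]
        rfl
      | zero => simp
      | add y z _ _ hy hz => rw [mul_add]; exact add_mem hy hz
      | smul r y _ hy => rw [mul_smul_comm]; exact Submodule.smul_mem _ r hy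
  | add a b ha hb => rw [add_mul]; exact add_mem ha hb
  | smul r a ha => rw [smul_mul_assoc]; exact Submodule.smul_mem _ r ha

theorem relator_mul_mem (f x : FreeBiset R G) (hx : x ∈ Submodule.span R (relators R G)) :
    x * f ∈ Submodule.span R (relators R G) := by
  induction f using MonoidAlgebra.induction_on with
  | of c =>
    induction c using Quotient.inductionOn with
    | _ L =>
      induction hx using Submodule.span_induction with
      | mem y hy =>
        obtain ⟨M, N, rfl⟩ := hy
        refine Submodule.subset_span ⟨tensor M L, tensor N L, ?_⟩
        have h : isoClass (disjUnion M N) * isoClass L =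
            isoClass (disjUnion (tensor M L) (tensor N L)) :=
          Quotient.sound ⟨disjUnionTensor M N L⟩
        change _ * MonoidAlgebra.of R _ (isoClass L) = _
        rw [sub_mul, sub_mul, ← map_mul, ← map_mul, ← map_mul, h]
        rfl
      | zero => simp
      | add y z _ _ hy hz => rw [add_mul]; exact add_mem hy hz
      | smul r y _ hy => rw [smul_mul_assoc]; exact Submodule.smul_mem _ r hy
  | add a b ha hb => rw [mul_add]; exact add_mem ha hb
  | smul r a ha => rw [mul_smul_comm]; exact Submodule.smul_mem _ r ha

/-- The `R`-submodule spanned by the elements `[M ⊔ N] - [M] - [N]`; it is a two-sided ideal. -/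
def relIdeal : Ideal (FreeBiset R G) where
  carrier := Submodule.span R (relators R G)
  add_mem' := add_mem
  zero_mem' := zero_mem _
  smul_mem' f x hx := mul_relator_mem R G f x hx

instance : (relIdeal R G).IsTwoSided where
  mul_mem_of_left {a} b ha := relator_mul_mem R G b a ha

/-- The double Burnside `R`-algebra `B_R(G,G)`. -/
abbrev B : Type 1 := FreeBiset R G ⧸ relIdeal R G

variable {G}

/-- The class `[M]` of a biset `M` in `B_R(G,G)`. -/
noncomputable def cls (M : Biset G) : B R G :=
  Ideal.Quotient.mk (relIdeal R G) (MonoidAlgebra.of R _ (isoClass M))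

theorem cls_mul (M N : Biset G) : cls R M * cls R N = cls R (tensor M N) := by
  unfold cls
  rw [← map_mul, ← map_mul, isoClass_mul]

theorem cls_disjUnion (M N : Biset G) : cls R (disjUnion M N) = cls R M + cls R N := by
  unfold cls
  rw [← map_add, Ideal.Quotient.eq, ← sub_sub]
  exact Submodule.subset_span ⟨M, N, rfl⟩

variable (G) {R}

/-- The change of coefficients `B_R(G,G) → B_S(G,G)`, `[M] ↦ [M]`. -/
noncomputable def mapB {S : Type} [CommRing S] (f : R →+* S) : B R G →+* B S G :=
  Ideal.quotientMap (relIdeal S G) (MonoidAlgebra.mapRingHom (BisetClass G) f) (by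
    intro x hx
    change x ∈ Submodule.span R (relators R G) at hx
    change MonoidAlgebra.mapRingHom (BisetClass G) f x ∈ Submodule.span S (relators S G)
    induction hx using Submodule.span_induction with
    | mem y hy =>
      obtain ⟨M, N, rfl⟩ := hy
      exact Submodule.subset_span ⟨M, N, by simp⟩
    | zero => simp
    | add y z _ _ hy hz => rw [map_add]; exact add_mem hy hz
    | smul r y _ hy =>
      have : MonoidAlgebra.mapRingHom (BisetClass G) f (r • y) =
          f r • MonoidAlgebra.mapRingHom (BisetClass G) f y := by
        ext; simp
      rw [this]; exact Submodule.smul_mem _ _ hy)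

theorem mapB_cls {S : Type} [CommRing S] (f : R →+* S) (M : Biset G) :
    mapB G f (cls R M) = cls S M := by
  simp [mapB, cls]

end

end DBurnside

/-! ## The algebra `A` and the subalgebra cut out by congruences -/

namespace DBurnside

/-- `S[η̄, ξ̄] = S[η, ξ] / (η², ηξ, ξ²)`, as the square-zero extension of `S` by the free module
with basis `η̄, ξ̄`. -/
abbrev Eps (S : Type) : Type := TrivSqZeroExt S (S × S)

/-- The element `z₁ + z₂ η̄ + z₃ ξ̄`. -/
def eps {S : Type} (z₁ z₂ z₃ : S) : Eps S := (z₁, (z₂, z₃))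

@[simp] theorem fst_eps {S : Type} (z₁ z₂ z₃ : S) : (eps z₁ z₂ z₃).fst = z₁ := rfl

@[simp] theorem snd_eps {S : Type} (z₁ z₂ z₃ : S) : (eps z₁ z₂ z₃).snd = (z₂, z₃) := rfl

/-- The element `η̄`. -/
def eta (S : Type) [CommRing S] : Eps S := TrivSqZeroExt.inr (1, 0)

/-- The element `ξ̄`. -/
def xi (S : Type) [CommRing S] : Eps S := TrivSqZeroExt.inr (0, 1)

theorem eps_eq {S : Type} [CommRing S] (z₁ z₂ z₃ : S) :
    eps z₁ z₂ z₃ = algebraMap S (Eps S) z₁ + z₂ • eta S + z₃ • xi S := by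
  apply TrivSqZeroExt.ext
  · simp [eta, xi, TrivSqZeroExt.algebraMap_eq_inl, fst_eps]
  · simp [eta, xi, TrivSqZeroExt.algebraMap_eq_inl, snd_eps]

/-- The direct sum of blocks
`[ S^{3×3}  0  0  S^{3×1} ]`
`[ 0        S  0  S       ]`
`[ 0        0  S  0       ]`
`[ S^{1×3}  S  0  S[η̄,ξ̄] ]`, with elements written
`[ s  0  0  t ]`
`[ 0  u  0  v ]`
`[ 0  0  w  0 ]`
`[ x  y  0  z ]`. -/
@[ext] structure A (S : Type) where
  s : Matrix (Fin 3) (Fin 3) S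
  t : Fin 3 → S
  u : S
  v : S
  w : S
  x : Fin 3 → S
  y : S
  z : Eps S

namespace A

open Matrix

variable {S : Type} [CommRing S]

instance : Zero (A S) := ⟨⟨0, 0, 0, 0, 0, 0, 0, 0⟩⟩
instance : One (A S) := ⟨⟨1, 0, 1, 0, 1, 0, 0, 1⟩⟩
instance : Add (A S) := ⟨fun a b =>
  ⟨a.s + b.s, a.t + b.t, a.u + b.u, a.v + b.v, a.w + b.w, a.x + b.x, a.y + b.y, a.z + b.z⟩⟩
instance : Neg (A S) := ⟨fun a => ⟨-a.s, -a.t, -a.u, -a.v, -a.w, -a.x, -a.y, -a.z⟩⟩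

/-- Block multiplication. The products of the blocks are the evident ones, where `η̄` and `ξ̄`
act as zero on the off-diagonal blocks, except that `(x, t) ↦ (x t) η̄`,
`(y, v) ↦ y v (ξ̄ - 12 η̄)`, `(t, x) ↦ 0` and `(v, y) ↦ 0`. -/
instance : Mul (A S) := ⟨fun a b =>
  { s := a.s * b.s
    t := a.s *ᵥ b.t + b.z.fst • a.t
    u := a.u * b.u
    v := a.u * b.v + a.v * b.z.fst
    w := a.w * b.w
    x := a.x ᵥ* b.s + a.z.fst • b.x
    y := a.y * b.u + a.z.fst * b.y
    z := (a.x ⬝ᵥ b.t) • eta S + (a.y * b.v) • (xi S - (12 : S) • eta S) + a.z * b.z }⟩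

/-- Scalars act on all blocks. -/
instance {K : Type} [SMul K S] : SMul K (A S) := ⟨fun k a =>
  ⟨k • a.s, k • a.t, k • a.u, k • a.v, k • a.w, k • a.x, k • a.y, k • a.z⟩⟩

section
variable (a b : A S)
@[simp] theorem zero_s : (0 : A S).s = 0 := rfl
@[simp] theorem zero_t : (0 : A S).t = 0 := rfl
@[simp] theorem zero_u : (0 : A S).u = 0 := rfl
@[simp] theorem zero_v : (0 : A S).v = 0 := rfl
@[simp] theorem zero_w : (0 : A S).w = 0 := rfl
@[simp] theorem zero_x : (0 : A S).x = 0 := rfl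
@[simp] theorem zero_y : (0 : A S).y = 0 := rfl
@[simp] theorem zero_z : (0 : A S).z = 0 := rfl
@[simp] theorem one_s : (1 : A S).s = 1 := rfl
@[simp] theorem one_t : (1 : A S).t = 0 := rfl
@[simp] theorem one_u : (1 : A S).u = 1 := rfl
@[simp] theorem one_v : (1 : A S).v = 0 := rfl
@[simp] theorem one_w : (1 : A S).w = 1 := rfl
@[simp] theorem one_x : (1 : A S).x = 0 := rfl
@[simp] theorem one_y : (1 : A S).y = 0 := rfl
@[simp] theorem one_z : (1 : A S).z = 1 := rfl
@[simp] theorem add_s : (a + b).s = a.s + b.s := rfl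
@[simp] theorem add_t : (a + b).t = a.t + b.t := rfl
@[simp] theorem add_u : (a + b).u = a.u + b.u := rfl
@[simp] theorem add_v : (a + b).v = a.v + b.v := rfl
@[simp] theorem add_w : (a + b).w = a.w + b.w := rfl
@[simp] theorem add_x : (a + b).x = a.x + b.x := rfl
@[simp] theorem add_y : (a + b).y = a.y + b.y := rfl
@[simp] theorem add_z : (a + b).z = a.z + b.z := rfl
@[simp] theorem neg_s : (-a).s = -a.s := rfl
@[simp] theorem neg_t : (-a).t = -a.t := rfl
@[simp] theorem neg_u : (-a).u = -a.u := rfl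
@[simp] theorem neg_v : (-a).v = -a.v := rfl
@[simp] theorem neg_w : (-a).w = -a.w := rfl
@[simp] theorem neg_x : (-a).x = -a.x := rfl
@[simp] theorem neg_y : (-a).y = -a.y := rfl
@[simp] theorem neg_z : (-a).z = -a.z := rfl
@[simp] theorem mul_s : (a * b).s = a.s * b.s := rfl
@[simp] theorem mul_t : (a * b).t = a.s *ᵥ b.t + b.z.fst • a.t := rfl
@[simp] theorem mul_u : (a * b).u = a.u * b.u := rfl
@[simp] theorem mul_v : (a * b).v = a.u * b.v + a.v * b.z.fst := rfl
@[simp] theorem mul_w : (a * b).w = a.w * b.w := rfl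
@[simp] theorem mul_x : (a * b).x = a.x ᵥ* b.s + a.z.fst • b.x := rfl
@[simp] theorem mul_y : (a * b).y = a.y * b.u + a.z.fst * b.y := rfl
theorem mul_z : (a * b).z =
    (a.x ⬝ᵥ b.t) • eta S + (a.y * b.v) • (xi S - (12 : S) • eta S) + a.z * b.z := rfl
@[simp] theorem mul_z_fst : (a * b).z.fst = a.z.fst * b.z.fst := by
  simp [mul_z, eta, xi]
@[simp] theorem mul_z_snd_fst : (a * b).z.snd.1 =
    a.x ⬝ᵥ b.t - 12 * (a.y * b.v) + a.z.fst * b.z.snd.1 + a.z.snd.1 * b.z.fst := by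
  simp [mul_z, eta, xi]; ring
@[simp] theorem mul_z_snd_snd : (a * b).z.snd.2 =
    a.y * b.v + a.z.fst * b.z.snd.2 + a.z.snd.2 * b.z.fst := by
  simp [mul_z, eta, xi]; ring
end

section
variable {S : Type} (a : A S)
variable {K : Type} [SMul K S] (k : K)
@[simp] theorem smul_s : (k • a).s = k • a.s := rfl
@[simp] theorem smul_t : (k • a).t = k • a.t := rfl
@[simp] theorem smul_u : (k • a).u = k • a.u := rfl
@[simp] theorem smul_v : (k • a).v = k • a.v := rfl
@[simp] theorem smul_w : (k • a).w = k • a.w := rfl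
@[simp] theorem smul_x : (k • a).x = k • a.x := rfl
@[simp] theorem smul_y : (k • a).y = k • a.y := rfl
@[simp] theorem smul_z : (k • a).z = k • a.z := rfl
end

theorem ext' {S : Type} {a b : A S} (hs : a.s = b.s) (ht : a.t = b.t) (hu : a.u = b.u) (hv : a.v = b.v)
    (hw : a.w = b.w) (hx : a.x = b.x) (hy : a.y = b.y) (h1 : a.z.fst = b.z.fst)
    (h2 : a.z.snd.1 = b.z.snd.1) (h3 : a.z.snd.2 = b.z.snd.2) : a = b :=
  A.ext hs ht hu hv hw hx hy (TrivSqZeroExt.ext h1 (Prod.ext h2 h3))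

instance : AddCommGroup (A S) where
  add_assoc a b c := by ext1 <;> simp [add_assoc]
  zero_add a := by ext1 <;> simp
  add_zero a := by ext1 <;> simp
  neg_add_cancel a := by ext1 <;> simp
  add_comm a b := by ext1 <;> simp [add_comm]
  nsmul := nsmulRec
  zsmul := zsmulRec

instance : Ring (A S) where
  left_distrib a b c := by
    apply ext' <;> simp [mul_add, Matrix.mulVec_add, Matrix.vecMul_add,
      dotProduct_add, add_smul, smul_add] <;> abel
  right_distrib a b c := by
    apply ext' <;> simp [mul_add, add_mul, Matrix.add_mulVec, Matrix.add_vecMul,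
      add_dotProduct, add_smul, smul_add] <;> abel
  zero_mul a := by apply ext' <;> simp
  mul_zero a := by apply ext' <;> simp
  one_mul a := by apply ext' <;> simp
  mul_one a := by apply ext' <;> simp
  mul_assoc a b c := by
    apply ext'
    · simp [mul_assoc]
    · simp [Matrix.mulVec_add, Matrix.mulVec_smul, smul_smul, smul_add, add_assoc, mul_comm]
    · simp [mul_assoc]
    · simp; ring
    · simp [mul_assoc]
    · simp [Matrix.add_vecMul, Matrix.smul_vecMul, smul_smul, smul_add, add_assoc]
    · simp; ring
    · simp [mul_assoc]
    · simp [Matrix.dotProduct_mulVec, add_dotProduct, dotProduct_add]; ring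
    · simp; ring
  zsmul := zsmulRec
  neg_add_cancel := neg_add_cancel

section
variable {K : Type} [CommRing K] [Algebra K S]

instance : Module K (A S) where
  one_smul a := by ext1 <;> simp
  mul_smul k l a := by ext1 <;> simp [mul_smul]
  smul_zero k := by ext1 <;> simp
  smul_add k a b := by ext1 <;> simp
  add_smul k l a := by ext1 <;> simp [add_smul]
  zero_smul a := by ext1 <;> simp

instance : Algebra K (A S) := Algebra.ofModule
  (fun k a b => by
    apply ext'
    · simp
    · simp [Matrix.smul_mulVec, smul_comm b.z.fst k a.t]
    · simp
    · simp
    · simp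
    · simp [Matrix.smul_vecMul, smul_assoc]
    · simp
    · simp
    · simp [smul_add, smul_sub]
    · simp [smul_add])
  (fun k a b => by
    apply ext'
    · simp
    · simp [Matrix.mulVec_smul, smul_assoc]
    · simp
    · simp
    · simp
    · simp [Matrix.vecMul_smul, smul_comm a.z.fst k b.x]
    · simp
    · simp
    · simp [smul_add, smul_sub]
    · simp [smul_add])

end

/-- The entrywise map `A_R → A_S` for an `R`-algebra `S`; for `R ⊆ S` it is the inclusion. -/
def map (R S : Type) [CommRing R] [CommRing S] [Algebra R S] : A R →ₐ[R] A S where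
  toFun a :=
    { s := a.s.map (algebraMap R S)
      t := algebraMap R S ∘ a.t
      u := algebraMap R S a.u
      v := algebraMap R S a.v
      w := algebraMap R S a.w
      x := algebraMap R S ∘ a.x
      y := algebraMap R S a.y
      z := eps (algebraMap R S a.z.fst) (algebraMap R S a.z.snd.1) (algebraMap R S a.z.snd.2) }
  map_one' := by
    apply ext'
    · exact Matrix.map_one _ (map_zero _) (map_one _)
    all_goals (try ext) <;> simp
  map_mul' a b := by
    apply ext' <;> (try ext) <;>
      simp [Matrix.mul_apply, Matrix.mulVec, Matrix.vecMul, dotProduct, map_ofNat,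
        -algebraMap_smul, ← algebraMap_smul S]
  map_zero' := by apply ext' <;> (try ext) <;> simp
  map_add' a b := by apply ext' <;> (try ext) <;> simp
  commutes' r := by
    rw [Algebra.algebraMap_eq_smul_one (A := A R) r, Algebra.algebraMap_eq_smul_one (A := A S) r]
    apply ext'
    · ext i j
      simp only [Matrix.map_apply, smul_s, one_s, Matrix.smul_apply]
      by_cases h : i = j
      · subst h; simp [Algebra.smul_def]
      · simp [h, Algebra.smul_def]
    all_goals
      (try ext) <;> simp only [smul_t, smul_u, smul_v, smul_w, smul_x, smul_y, smul_z, one_t,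
        one_u, one_v, one_w, one_x, one_y, one_z, fst_eps, snd_eps, TrivSqZeroExt.fst_smul,
        TrivSqZeroExt.snd_smul] <;> simp [Algebra.smul_def]

end A

/-- The ring `Z_(2)` of rational numbers with odd denominator. -/
def Z2 : Subring ℚ where
  carrier := {q | Odd q.den}
  mul_mem' {a b} ha hb := Odd.of_dvd_nat (Odd.mul ha hb) (Rat.mul_den_dvd a b)
  one_mem' := by simp
  add_mem' {a b} ha hb := Odd.of_dvd_nat (Odd.mul ha hb) (Rat.add_den_dvd a b)
  zero_mem' := by simp
  neg_mem' {a} ha := by simpa using ha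

/-- The subalgebra of `A_{Z_(2)}` given by the congruences; here `c ∣ a - b` in `Z_(2)`
expresses `a ≡ b` modulo `c`, and `z = z₁ + z₂ η̄ + z₃ ξ̄`. -/
def congruenceAlgebra : Subalgebra Z2 (A Z2) where
  carrier := {a |
    ((8 : Z2) ∣ (2 * a.w - 2 * a.z.fst) - a.z.snd.1 ∧ (4 : Z2) ∣ a.z.snd.1 - a.z.snd.2 ∧
      (4 : Z2) ∣ a.z.snd.2) ∧
    (∀ i, (4 : Z2) ∣ a.x i) ∧ (2 : Z2) ∣ a.y ∧ (∀ i, (2 : Z2) ∣ a.t i) ∧ (2 : Z2) ∣ a.v}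
  mul_mem' {a b} := by
    rintro ⟨⟨h1, h2, h3⟩, hx, hy, ht, hv⟩ ⟨⟨k1, k2, k3⟩, kx, ky, kt, kv⟩
    have h4 : (4 : Z2) ∣ a.z.snd.1 := by simpa using dvd_add h2 h3
    have k4 : (4 : Z2) ∣ b.z.snd.1 := by simpa using dvd_add k2 k3
    have hxt : (8 : Z2) ∣ a.x ⬝ᵥ b.t := by
      refine Finset.dvd_sum fun i _ => ?_
      have := mul_dvd_mul (hx i) (kt i)
      norm_num at this
      exact this
    obtain ⟨p, hp⟩ := hxt
    obtain ⟨y, hy'⟩ := hy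
    obtain ⟨v, kv'⟩ := kv
    obtain ⟨c1, hc1⟩ := h1
    obtain ⟨d1, hd1⟩ := k1
    obtain ⟨c3, hc3⟩ := h3
    obtain ⟨d3, hd3⟩ := k3
    obtain ⟨c4, hc4⟩ := h4
    obtain ⟨d4, hd4⟩ := k4
    have hz3 : (4 : Z2) ∣ (a * b).z.snd.2 := by
      rw [A.mul_z_snd_snd, hy', kv', hd3, hc3]
      exact ⟨y * v + a.z.fst * d3 + c3 * b.z.fst, by ring⟩
    have hz2 : (4 : Z2) ∣ (a * b).z.snd.1 := by
      rw [A.mul_z_snd_fst, hp, hy', kv', hc4, hd4]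
      exact ⟨2 * p - 12 * (y * v) + a.z.fst * d4 + c4 * b.z.fst, by ring⟩
    refine ⟨⟨?_, dvd_sub hz2 hz3, hz3⟩, ?_, ?_, ?_, ?_⟩
    · refine ⟨a.z.fst * d1 + c1 * b.w + c4 * (d4 + 2 * d1) - p + 6 * (y * v), ?_⟩
      rw [A.mul_z_snd_fst, A.mul_z_fst, A.mul_w, hp, hy', kv']
      linear_combination b.w * hc1 + a.z.fst * hd1 + (b.w - b.z.fst) * hc4 + 2 * c4 * hd1 +
        2 * c4 * hd4
    · intro i
      change (4 : Z2) ∣ (∑ j, a.x j * b.s j i) + a.z.fst * b.x i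
      refine dvd_add (Finset.dvd_sum fun j _ => ?_) ?_
      · exact Dvd.dvd.mul_right (hx j) _
      · exact Dvd.dvd.mul_left (kx i) _
    · exact dvd_add (Dvd.dvd.mul_right ⟨y, hy'⟩ _) (Dvd.dvd.mul_left ky _)
    · intro i
      change (2 : Z2) ∣ (∑ j, a.s i j * b.t j) + b.z.fst * a.t i
      refine dvd_add (Finset.dvd_sum fun j _ => ?_) ?_
      · exact Dvd.dvd.mul_left (kt j) _
      · exact Dvd.dvd.mul_left (ht i) _
    · exact dvd_add (Dvd.dvd.mul_left ⟨v, kv'⟩ _) (Dvd.dvd.mul_right hv _)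
  one_mem' := by simp
  add_mem' {a b} := by
    rintro ⟨⟨h1, h2, h3⟩, hx, hy, ht, hv⟩ ⟨⟨k1, k2, k3⟩, kx, ky, kt, kv⟩
    refine ⟨⟨?_, ?_, ?_⟩, fun i => dvd_add (hx i) (kx i), dvd_add hy ky,
      fun i => dvd_add (ht i) (kt i), dvd_add hv kv⟩
    · convert dvd_add h1 k1 using 1; simp; ring
    · convert dvd_add h2 k2 using 1; simp; ring
    · exact dvd_add h3 k3
  zero_mem' := by simp
  algebraMap_mem' r := by simp [Algebra.algebraMap_eq_smul_one]

/-! ## The group `S₃` and the isomorphism between `A` and the rational double Burnside algebra -/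

open Biset

abbrev S3 : Type := Equiv.Perm (Fin 3)

/-- The transposition `(1,2)`. -/
def a : S3 := Equiv.swap 0 1

/-- The three-cycle `(1,2,3)`. -/
def b : S3 := finRotate 3

def V0 : Subgroup S3 := ⊥
def V1 : Subgroup S3 := Subgroup.closure {a}
def V4 : Subgroup S3 := Subgroup.closure {b}
def V5 : Subgroup S3 := ⊤

/-- The class of `(S₃ × S₃) / U` in `B_ℚ(S₃,S₃)`. -/
noncomputable def H (U : Subgroup (S3 × S3)) : B ℚ S3 := cls ℚ (ofSubgroup U)

noncomputable def H00 : B ℚ S3 := H (V0.prod V0)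
noncomputable def H10 : B ℚ S3 := H (V1.prod V0)
noncomputable def H01 : B ℚ S3 := H (V0.prod V1)
noncomputable def HD1 : B ℚ S3 := H (Subgroup.closure {(a, a)})
noncomputable def H40 : B ℚ S3 := H (V4.prod V0)
noncomputable def H04 : B ℚ S3 := H (V0.prod V4)
noncomputable def HD4 : B ℚ S3 := H (Subgroup.closure {(b, b)})
noncomputable def H11 : B ℚ S3 := H (V1.prod V1)
noncomputable def H50 : B ℚ S3 := H (V5.prod V0)
noncomputable def H05 : B ℚ S3 := H (V0.prod V5)
noncomputable def H6 : B ℚ S3 := H (Subgroup.closure {(a, a), (1, b)})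
noncomputable def H41 : B ℚ S3 := H (V4.prod V1)
noncomputable def H14 : B ℚ S3 := H (V1.prod V4)
noncomputable def H7 : B ℚ S3 := H (Subgroup.closure {(a, a), (b, 1)})
noncomputable def HD5 : B ℚ S3 := H (Subgroup.closure {(a, a), (b, b)})
noncomputable def H44 : B ℚ S3 := H (V4.prod V4)
noncomputable def H15 : B ℚ S3 := H (V1.prod V5)
noncomputable def H51 : B ℚ S3 := H (V5.prod V1)
noncomputable def H45 : B ℚ S3 := H (V4.prod V5)
noncomputable def H54 : B ℚ S3 := H (V5.prod V4)
noncomputable def H8 : B ℚ S3 := H (Subgroup.closure {(a, a), (b, 1), (1, b)})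
noncomputable def H55 : B ℚ S3 := H (V5.prod V5)

noncomputable def e : B ℚ S3 :=
  (-1/2 : ℚ) • H00 + H10 + (1/2 : ℚ) • H40
noncomputable def b_eg : B ℚ S3 :=
  (1/2 : ℚ) • H00 - H10 - (1/2 : ℚ) • H01 - (1/2 : ℚ) • H40 + H11 + (1/2 : ℚ) • H41
noncomputable def b_eh : B ℚ S3 :=
  (-1/8 : ℚ) • H00 + (1/4 : ℚ) • H10 + (1/2 : ℚ) • H01 + (1/8 : ℚ) • H40 - (3/8 : ℚ) • H04 - H11
    - (1/2 : ℚ) • H41 + (3/4 : ℚ) • H14 + (3/8 : ℚ) • H44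
noncomputable def b_ge : B ℚ S3 :=
  (-4/3 : ℚ) • H00 + (2 : ℚ) • H10 + H40
noncomputable def g : B ℚ S3 :=
  (4/3 : ℚ) • H00 - (2 : ℚ) • H10 - (4/3 : ℚ) • H01 - H40 + (2 : ℚ) • H11 + H41
noncomputable def b_gh : B ℚ S3 :=
  (-1/3 : ℚ) • H00 + (1/2 : ℚ) • H10 + (4/3 : ℚ) • H01 + (1/4 : ℚ) • H40 - H04 - (2 : ℚ) • H11
    - H41 + (3/2 : ℚ) • H14 + (3/4 : ℚ) • H44
noncomputable def b_he : B ℚ S3 :=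
  (-1/3 : ℚ) • H00 + H40
noncomputable def b_hg : B ℚ S3 :=
  (1/3 : ℚ) • H00 - (1/3 : ℚ) • H01 - H40 + H41
noncomputable def h : B ℚ S3 :=
  (-1/12 : ℚ) • H00 + (1/3 : ℚ) • H01 + (1/4 : ℚ) • H40 - (1/4 : ℚ) • H04 + (3/4 : ℚ) • H44
    - H41
noncomputable def b_e4 : B ℚ S3 :=
  (-1/8 : ℚ) • H00 + (1/4 : ℚ) • H10 + (1/4 : ℚ) • H01 + (1/8 : ℚ) • H40 + (1/8 : ℚ) • H04
    - (1/2 : ℚ) • H11 - (1/4 : ℚ) • H05 - (1/4 : ℚ) • H41 - (1/4 : ℚ) • H14 - (1/8 : ℚ) • H44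
    + (1/2 : ℚ) • H15 + (1/4 : ℚ) • H45
noncomputable def b_g4 : B ℚ S3 :=
  (-1/3 : ℚ) • H00 + (1/2 : ℚ) • H10 + (2/3 : ℚ) • H01 + (1/4 : ℚ) • H40 + (1/3 : ℚ) • H04 - H11
    - (2/3 : ℚ) • H05 - (1/2 : ℚ) • H41 - (1/2 : ℚ) • H14 - (1/4 : ℚ) • H44 + H15
    + (1/2 : ℚ) • H45
noncomputable def b_h4 : B ℚ S3 :=
  (-1/12 : ℚ) • H00 + (1/6 : ℚ) • H01 + (1/4 : ℚ) • H40 + (1/12 : ℚ) • H04 - (1/6 : ℚ) • H05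
    - (1/2 : ℚ) • H41 - (1/4 : ℚ) • H44 + (1/2 : ℚ) • H45
noncomputable def ε₂ : B ℚ S3 :=
  -H00 + H10 + H01 + HD1 - (2 : ℚ) • H11
noncomputable def b_24 : B ℚ S3 :=
  (-1/2 : ℚ) • H00 + (1/2 : ℚ) • H10 + (1/2 : ℚ) • H01 + (1/2 : ℚ) • HD1 + (1/2 : ℚ) • H04 - H11
    - (1/2 : ℚ) • H05 - (1/2 : ℚ) • H6 - (1/2 : ℚ) • H14 + H15
noncomputable def ε₃ : B ℚ S3 :=
  (-1/4 : ℚ) • H00 + (1/4 : ℚ) • H40 + (1/4 : ℚ) • H04 + (1/2 : ℚ) • HD4 - (3/4 : ℚ) • H44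
noncomputable def b_4e : B ℚ S3 :=
  (1/6 : ℚ) • H00 - (1/3 : ℚ) • H10 - (1/6 : ℚ) • H40 + (1/3 : ℚ) • H50
noncomputable def b_4g : B ℚ S3 :=
  (-1/6 : ℚ) • H00 + (1/3 : ℚ) • H10 + (1/6 : ℚ) • H01 + (1/6 : ℚ) • H40 - (1/3 : ℚ) • H11
    - (1/3 : ℚ) • H50 - (1/6 : ℚ) • H41 + (1/3 : ℚ) • H51
noncomputable def b_4h : B ℚ S3 :=
  (1/24 : ℚ) • H00 - (1/12 : ℚ) • H10 - (1/6 : ℚ) • H01 - (1/24 : ℚ) • H40 + (1/8 : ℚ) • H04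
    + (1/3 : ℚ) • H11 + (1/12 : ℚ) • H50 + (1/6 : ℚ) • H41 - (1/4 : ℚ) • H14 - (1/8 : ℚ) • H44
    - (1/3 : ℚ) • H51 + (1/4 : ℚ) • H54
noncomputable def b_42 : B ℚ S3 :=
  (-1/2 : ℚ) • H00 + (1/2 : ℚ) • H10 + (1/2 : ℚ) • H01 + (1/2 : ℚ) • HD1 + (1/2 : ℚ) • H40 - H11
    - (1/2 : ℚ) • H50 - (1/2 : ℚ) • H41 - (1/2 : ℚ) • H7 + H51
noncomputable def ε₄ : B ℚ S3 :=
  (1/2 : ℚ) • H00 - HD1 - (1/2 : ℚ) • HD4 + HD5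
noncomputable def bEta : B ℚ S3 :=
  (1/24 : ℚ) • H00 - (1/12 : ℚ) • H10 - (1/12 : ℚ) • H01 - (1/24 : ℚ) • H40 - (1/24 : ℚ) • H04
    + (1/6 : ℚ) • H11 + (1/12 : ℚ) • H50 + (1/12 : ℚ) • H05 + (1/12 : ℚ) • H41
    + (1/12 : ℚ) • H14 + (1/24 : ℚ) • H44 - (1/6 : ℚ) • H15 - (1/6 : ℚ) • H51 - (1/12 : ℚ) • H45
    - (1/12 : ℚ) • H54 + (1/6 : ℚ) • H55
noncomputable def bXi : B ℚ S3 :=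
  (1/4 : ℚ) • H00 - (3/4 : ℚ) • H10 - (3/4 : ℚ) • H01 + (1/4 : ℚ) • HD1 - (1/4 : ℚ) • H40
    - (1/4 : ℚ) • H04 + (3/2 : ℚ) • H11 + (3/4 : ℚ) • H50 + (3/4 : ℚ) • H05 - (1/4 : ℚ) • H6
    + (3/4 : ℚ) • H41 + (3/4 : ℚ) • H14 - (1/4 : ℚ) • H7 + (1/4 : ℚ) • H44 - (3/2 : ℚ) • H15
    - (3/2 : ℚ) • H51 - (3/4 : ℚ) • H45 - (3/4 : ℚ) • H54 + (1/4 : ℚ) • H8 + (3/2 : ℚ) • H55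

/-- The map `γ : A → B_ℚ(S₃,S₃)`. -/
noncomputable def gamma (m : A ℚ) : B ℚ S3 :=
  (m.s 0 0 • e + m.s 0 1 • b_eg + m.s 0 2 • b_eh
    + m.s 1 0 • b_ge + m.s 1 1 • g + m.s 1 2 • b_gh
    + m.s 2 0 • b_he + m.s 2 1 • b_hg + m.s 2 2 • h)
  + (m.t 0 • b_e4 + m.t 1 • b_g4 + m.t 2 • b_h4)
  + m.u • ε₂ + m.v • b_24 + m.w • ε₃
  + (m.x 0 • b_4e + m.x 1 • b_4g + m.x 2 • b_4h)
  + m.y • b_42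
  + (m.z.fst • ε₄ + m.z.snd.1 • bEta + m.z.snd.2 • bXi)

open Matrix in
/-- The first conjugating unit of `A`. -/
def x₁ : (A ℚ)ˣ where
  val := ⟨!![0, -2, 0; 6, 6, -4; 0, 0, 1], 0, 1, 0, 1, 0, 0, 1⟩
  inv := ⟨!![1/2, 1/6, 2/3; -1/2, 0, 0; 0, 0, 1], 0, 1, 0, 1, 0, 0, 1⟩
  val_inv := by
    apply A.ext'
    · ext i j; fin_cases i <;> fin_cases j <;>
        simp [Matrix.mul_apply, Fin.sum_univ_three]
      all_goals norm_num
    all_goals simp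
  inv_val := by
    apply A.ext'
    · ext i j; fin_cases i <;> fin_cases j <;>
        simp [Matrix.mul_apply, Fin.sum_univ_three]
      all_goals norm_num
    all_goals simp

open Matrix in
/-- The second conjugating unit of `A`. -/
def x₂ : (A ℚ)ˣ where
  val := ⟨!![1, 0, 0; 0, 1, 0; 0, 7, 1], 0, 1, 0, 1, 0, 0, 1⟩
  inv := ⟨!![1, 0, 0; 0, 1, 0; 0, -7, 1], 0, 1, 0, 1, 0, 0, 1⟩
  val_inv := by
    apply A.ext'
    · ext i j; fin_cases i <;> fin_cases j <;>
        simp [Matrix.mul_apply, Fin.sum_univ_three]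
    all_goals simp
  inv_val := by
    apply A.ext'
    · ext i j; fin_cases i <;> fin_cases j <;>
        simp [Matrix.mul_apply, Fin.sum_univ_three]
    all_goals simp

open Matrix in
/-- The third conjugating unit of `A`. -/
def x₃ : (A ℚ)ˣ where
  val := ⟨1, ![0, 0, 1], 1, 0, 1, ![0, 0, 6], 0, 1⟩
  inv := ⟨1, ![0, 0, -1], 1, 0, 1, ![0, 0, -6], 0, eps 1 6 0⟩
  val_inv := by
    apply A.ext' <;> simp
  inv_val := by
    apply A.ext' <;> simp

/-- The map `δ : B_ℤ(S₃,S₃) → A`, `y ↦ x₃⁻¹ x₂⁻¹ x₁⁻¹ γ⁻¹(y) x₁ x₂ x₃`, formed with an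
algebra isomorphism `γ` as first argument. -/
noncomputable def delta (γ : A ℚ ≃ₐ[ℚ] B ℚ S3) (y : B ℤ S3) : A ℚ :=
  ↑x₃⁻¹ * ↑x₂⁻¹ * ↑x₁⁻¹ * γ.symm (mapB S3 (Int.castRingHom ℚ) y) * ↑x₁ * ↑x₂ * ↑x₃

/-- The localisation at `2` of a subset `L` of `A`: its `Z_(2)`-linear span in `A`. -/
def localisation (L : Set (A ℚ)) : Submodule Z2 (A ℚ) := Submodule.span Z2 L

end DBurnside

namespace DBurnside

open MulOpposite (op)
open Biset

/-! ## Bisets as sets with an action of `G × G` -/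

section Generic

variable {G : Type} [Group G]

/-- The composition `S * T` of two subgroups of `G × G`, viewed as relations. -/
def star (S T : Subgroup (G × G)) : Subgroup (G × G) where
  carrier := {q | ∃ y, (q.1, y) ∈ S ∧ (y, q.2) ∈ T}
  one_mem' := ⟨1, S.one_mem, T.one_mem⟩
  mul_mem' := by
    rintro p q ⟨y, h1, h2⟩ ⟨y', h3, h4⟩
    exact ⟨y * y', S.mul_mem h1 h3, T.mul_mem h2 h4⟩
  inv_mem' := by
    rintro p ⟨y, h1, h2⟩
    exact ⟨y⁻¹, S.inv_mem h1, T.inv_mem h2⟩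

theorem mem_star {S T : Subgroup (G × G)} {x z : G} :
    (x, z) ∈ star S T ↔ ∃ y, (x, y) ∈ S ∧ (y, z) ∈ T := Iff.rfl

/-- The number of `y` with `(1, y) ∈ S` and `(y, 1) ∈ T`. -/
noncomputable def link (S T : Subgroup (G × G)) : ℕ :=
  Nat.card {y : G // ((1 : G), y) ∈ S ∧ (y, (1 : G)) ∈ T}

/-- The image of `S` under conjugation by `(h⁻¹, g)`. -/
def twist (h : G) (S : Subgroup (G × G)) (g : G) : Subgroup (G × G) where
  carrier := {q | (h * q.1 * h⁻¹, g⁻¹ * q.2 * g) ∈ S}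
  one_mem' := by
    change (h * 1 * h⁻¹, g⁻¹ * 1 * g) ∈ S
    convert S.one_mem using 1
    exact Prod.ext (by simp) (by simp)
  mul_mem' := by
    intro p q hp hq
    simpa [mul_assoc] using S.mul_mem hp hq
  inv_mem' := by
    intro p hp
    simpa [mul_assoc] using S.inv_mem hp

theorem mem_twist {h g : G} {S : Subgroup (G × G)} {x z : G} :
    (x, z) ∈ twist h S g ↔ (h * x * h⁻¹, g⁻¹ * z * g) ∈ S := Iff.rfl

@[simp] theorem twist_one (S : Subgroup (G × G)) : twist 1 S 1 = S := by
  ext ⟨x, z⟩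
  simp [mem_twist]

theorem twist_twist (h h' : G) (S : Subgroup (G × G)) (g g' : G) :
    twist h' (twist h S g) g' = twist (h * h') S (g' * g) := by
  ext ⟨x, z⟩
  simp [mem_twist, mul_assoc]

theorem star_twist (h k : G) (S T : Subgroup (G × G)) (g l : G) :
    star (twist h S g) (twist k T l) = twist h (star (twist 1 S (k * g)) T) l := by
  ext ⟨x, z⟩
  simp only [mem_twist, mem_star]
  constructor
  · rintro ⟨y, h1, h2⟩
    exact ⟨k * y * k⁻¹, by simpa [mul_assoc] using h1, h2⟩
  · rintro ⟨y, h1, h2⟩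
    exact ⟨k⁻¹ * y * k, by simpa [mul_assoc] using h1, by simpa [mul_assoc] using h2⟩

theorem link_twist (h k : G) (S T : Subgroup (G × G)) (g l : G) :
    link (twist h S g) (twist k T l) = link (twist 1 S (k * g)) T := by
  refine Nat.card_congr ((MulAut.conj k).toEquiv.subtypeEquiv fun y => ?_)
  simp [mem_twist, mul_assoc]

namespace Biset

/-- The action of `G × G` on a `(G,G)`-biset, `(h, p) · m = h m p⁻¹`. -/
instance (M : Biset G) : MulAction (G × G) M.carrier where
  smul q m := q.1 • op q.2⁻¹ • m
  one_smul m := by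
    change (1 : G) • op (1 : G)⁻¹ • m = m
    simp
  mul_smul p q m := by
    change (p.1 * q.1) • op (p.2 * q.2)⁻¹ • m = p.1 • op p.2⁻¹ • q.1 • op q.2⁻¹ • m
    rw [mul_inv_rev, MulOpposite.op_mul, mul_smul, mul_smul,
      smul_comm q.1 (op p.2⁻¹)]

theorem prod_smul_def (M : Biset G) (q : G × G) (m : M.carrier) :
    q • m = q.1 • op q.2⁻¹ • m := rfl

theorem left_smul_eq (M : Biset G) (h : G) (m : M.carrier) : h • m = ((h, 1) : G × G) • m := by
  simp [prod_smul_def]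

theorem right_smul_eq (M : Biset G) (p : G) (m : M.carrier) :
    op p • m = ((1, p⁻¹) : G × G) • m := by
  simp [prod_smul_def]

/-- The stabiliser in `G × G` of a point of a biset. -/
abbrev stab (M : Biset G) (m : M.carrier) : Subgroup (G × G) := MulAction.stabilizer (G × G) m

theorem mem_stab {M : Biset G} {m : M.carrier} {q : G × G} : q ∈ stab M m ↔ q • m = m := Iff.rfl

/-- A `G × G`-equivariant bijection is an isomorphism of bisets. -/
def isoOfEquiv {M N : Biset G} (f : M.carrier ≃ N.carrier)
    (hf : ∀ (q : G × G) m, f (q • m) = q • f m) : Iso M N where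
  toEquiv := f
  map_left g m := by
    have := hf (g, 1) m
    rwa [← left_smul_eq, ← left_smul_eq] at this
  map_right g m := by
    have := hf (1, g⁻¹) m
    rwa [← right_smul_eq, ← right_smul_eq] at this

theorem Iso.map_smul {M N : Biset G} (f : Iso M N) (q : G × G) (m : M.carrier) :
    f.toEquiv (q • m) = q • f.toEquiv m := by
  have h1 := f.map_left q.1 (op q.2⁻¹ • m)
  have h2 := f.map_right q.2⁻¹ m
  simp only [Equiv.toFun_as_coe] at h1 h2
  rw [prod_smul_def, h1, h2, prod_smul_def]

theorem Iso.stab_eq {M N : Biset G} (f : Iso M N) (m : M.carrier) :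
    stab N (f.toEquiv m) = stab M m := by
  ext q
  rw [MulAction.mem_stabilizer_iff, MulAction.mem_stabilizer_iff, ← f.map_smul,
    f.toEquiv.apply_eq_iff_eq]

theorem stab_inl (M N : Biset G) (m : M.carrier) :
    stab (disjUnion M N) (Sum.inl m) = stab M m := by
  ext q
  exact Sum.inl_injective.eq_iff

theorem stab_inr (M N : Biset G) (n : N.carrier) :
    stab (disjUnion M N) (Sum.inr n) = stab N n := by
  ext q
  exact Sum.inr_injective.eq_iff

theorem tmk_eq_iff {M N : Biset G} (m m' : M.carrier) (n n' : N.carrier) :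
    (tmk m n : TensorSet M N) = tmk m' n' ↔ ∃ g : G, m' = op g⁻¹ • m ∧ n' = g • n := by
  refine Quotient.eq.trans (exists_congr fun g => ?_)
  exact Prod.ext_iff

theorem stab_tmk {M N : Biset G} (m : M.carrier) (n : N.carrier) :
    stab (tensor M N) (tmk m n) = star (stab M m) (stab N n) := by
  ext ⟨x, z⟩
  rw [mem_star]
  change tmk (x • m) (op z⁻¹ • n) = tmk m n ↔ _
  rw [eq_comm, tmk_eq_iff]
  constructor
  · rintro ⟨g, h1, h2⟩
    refine ⟨g⁻¹, ?_, ?_⟩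
    · rw [MulAction.mem_stabilizer_iff, prod_smul_def]
      change x • op g⁻¹⁻¹ • m = m
      rw [smul_comm, h1, smul_smul]
      simp
    · rw [MulAction.mem_stabilizer_iff, prod_smul_def]
      change g⁻¹ • op z⁻¹ • n = n
      rw [h2, smul_smul]
      simp
  · rintro ⟨y, h1, h2⟩
    rw [MulAction.mem_stabilizer_iff, prod_smul_def] at h1 h2
    refine ⟨y⁻¹, ?_, ?_⟩
    · nth_rewrite 2 [← h1]
      rw [smul_comm x (op y⁻¹) m, smul_smul, ← MulOpposite.op_mul]
      simp
    · nth_rewrite 2 [← h2]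
      change _ = y⁻¹ • y • op z⁻¹ • n
      rw [smul_smul]
      simp

theorem ofSubgroup_prod_smul [Finite G] (U : Subgroup (G × G)) (q x : G × G) :
    q • (show (ofSubgroup U).carrier from ((x : G × G) : (G × G) ⧸ U)) =
      (((q * x : G × G)) : (G × G) ⧸ U) := by
  obtain ⟨a, b⟩ := x
  rw [prod_smul_def, ofSubgroup_op_smul]
  refine (ofSubgroup_smul _ _ _ _).trans ?_
  rw [inv_inv]
  rfl

theorem stab_ofSubgroup [Finite G] (U : Subgroup (G × G)) (x : G × G) :
    stab (ofSubgroup U) (((x : G × G) : (G × G) ⧸ U)) = twist x.1⁻¹ U x.2 := by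
  ext ⟨p, q⟩
  refine mem_stab.trans ?_
  rw [ofSubgroup_prod_smul, mem_twist]
  refine QuotientGroup.eq.trans ?_
  rw [← U.inv_mem_iff]
  simp only [mul_inv_rev, inv_inv, mul_assoc]
  rfl

/-- The biset of a conjugate subgroup. -/
theorem ofSubgroup_twist_iso [Finite G] (h : G) (U : Subgroup (G × G)) (g : G) :
    Nonempty (Iso (ofSubgroup (twist h U g)) (ofSubgroup U)) := by
  let c : G × G := (h⁻¹, g)
  have key (x y : G × G) : x⁻¹ * y ∈ twist h U g ↔ (x * c)⁻¹ * (y * c) ∈ U := by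
    obtain ⟨x1, x2⟩ := x
    obtain ⟨y1, y2⟩ := y
    simp [c, mul_assoc]
    exact Iff.of_eq (by rw [mem_twist]; simp [mul_assoc])
  let f : (G × G) ⧸ twist h U g → (G × G) ⧸ U :=
    Quotient.lift (fun x => ((x * c : G × G) : (G × G) ⧸ U)) (fun x y hxy =>
      QuotientGroup.eq.2 ((key x y).1 (QuotientGroup.leftRel_apply.1 hxy)))
  have hf : Function.Bijective f := by
    constructor
    · intro x y
      induction x using QuotientGroup.induction_on with | _ x =>
      induction y using QuotientGroup.induction_on with | _ y =>
      intro hxy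
      exact QuotientGroup.eq.2 ((key x y).2 (QuotientGroup.eq.1 hxy))
    · intro y
      induction y using QuotientGroup.induction_on with | _ y =>
      exact ⟨((y * c⁻¹ : G × G) : (G × G) ⧸ twist h U g),
        congrArg QuotientGroup.mk (inv_mul_cancel_right y c)⟩
  refine ⟨isoOfEquiv (M := ofSubgroup (twist h U g)) (N := ofSubgroup U)
    (Equiv.ofBijective f hf) fun q x => ?_⟩
  induction x using QuotientGroup.induction_on with | _ x =>
  rw [ofSubgroup_prod_smul]
  refine Eq.trans ?_ (ofSubgroup_prod_smul U q (x * c)).symm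
  change ((q * x * c : G × G) : (G × G) ⧸ U) = _
  rw [mul_assoc]

end Biset

end Generic

/-! ## Linear maps out of the double Burnside algebra -/

section Ghost

variable {G : Type} [Group G] {X : Type*} [AddCommGroup X]

/-- The sum of `F (stab m)` over the points of a biset. -/
noncomputable def stabSum (F : Subgroup (G × G) → X) (M : Biset G) : X :=
  ∑ᶠ m : M.carrier, F (stab M m)

theorem stabSum_iso (F : Subgroup (G × G) → X) {M N : Biset G} (f : Iso M N) :
    stabSum F M = stabSum F N :=
  finsum_eq_of_bijective f.toEquiv f.toEquiv.bijective fun m => by rw [f.stab_eq]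

theorem stabSum_disjUnion (F : Subgroup (G × G) → X) (M N : Biset G) :
    stabSum F (disjUnion M N) = stabSum F M + stabSum F N := by
  let := Fintype.ofFinite M.carrier
  let := Fintype.ofFinite N.carrier
  let : Fintype (disjUnion M N).carrier := inferInstanceAs (Fintype (M.carrier ⊕ N.carrier))
  rw [stabSum, stabSum, stabSum, finsum_eq_sum_of_fintype, finsum_eq_sum_of_fintype,
    finsum_eq_sum_of_fintype]
  refine (Fintype.sum_sum_type _).trans ?_
  simp only [stab_inl, stab_inr]

/-- `stabSum` on isomorphism classes. -/
noncomputable def classSum (F : Subgroup (G × G) → X) : BisetClass G → X :=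
  Quotient.lift (stabSum F) fun _ _ h => h.elim fun f => stabSum_iso F f

variable [Finite G] (R : Type) [CommRing R] [Module R X]

/-- The linear map `B_R(G,G) → X` with `[M] ↦ ∑ m, F (stab m)`. -/
noncomputable def ghost (F : Subgroup (G × G) → X) : B R G →ₗ[R] X :=
  (((relIdeal R G).restrictScalars R).liftQ
    (Finsupp.linearCombination R (classSum F) ∘ₗ
      (MonoidAlgebra.coeffLinearEquiv R).toLinearMap) (by
      refine Submodule.span_le.2 ?_
      rintro _ ⟨M, N, rfl⟩
      rw [SetLike.mem_coe, LinearMap.mem_ker, map_sub, map_sub]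
      simp only [MonoidAlgebra.of_apply, LinearMap.comp_apply, LinearEquiv.coe_coe,
        MonoidAlgebra.coeffLinearEquiv_apply, MonoidAlgebra.coeff_single,
        Finsupp.linearCombination_single, one_smul]
      change stabSum F (disjUnion M N) - stabSum F M - stabSum F N = 0
      rw [stabSum_disjUnion]
      abel)) ∘ₗ (Submodule.Quotient.restrictScalarsEquiv R (relIdeal R G)).symm.toLinearMap

@[simp] theorem ghost_cls (F : Subgroup (G × G) → X) (M : Biset G) :
    ghost R F (cls R M) = stabSum F M := by
  change Finsupp.linearCombination R (classSum F)
    (MonoidAlgebra.of R _ (isoClass M)).coeff = _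
  simp only [MonoidAlgebra.of_apply, MonoidAlgebra.coeff_single,
        Finsupp.linearCombination_single, one_smul]
  rfl

theorem cls_iso {M N : Biset G} (f : Iso M N) : cls R M = cls R N := by
  unfold cls
  rw [show isoClass M = isoClass N from Quotient.sound ⟨f⟩]

theorem span_cls : Submodule.span R (Set.range (cls R : Biset G → B R G)) = ⊤ := by
  rw [eq_top_iff]
  rintro x -
  obtain ⟨x, rfl⟩ := Ideal.Quotient.mk_surjective x
  induction x using MonoidAlgebra.induction_on with
  | of c =>
    induction c using Quotient.inductionOn with
    | _ M => exact Submodule.subset_span ⟨M, rfl⟩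
  | add x y hx hy => rw [map_add]; exact add_mem hx hy
  | smul r x hx => exact Submodule.smul_mem _ r hx

theorem mem_orbit_of_smul_mem {Γ Y : Type*} [Group Γ] [MulAction Γ Y] {q : Γ} {x m : Y}
    (h : q • x ∈ MulAction.orbit Γ m) : x ∈ MulAction.orbit Γ m := by
  obtain ⟨p, hp⟩ := h
  exact ⟨q⁻¹ * p, by simpa [mul_smul, inv_smul_eq_iff] using hp⟩

/-- The complement of an orbit. -/
def orbitCompl (M : Biset G) (m : M.carrier) : Biset G where
  carrier := {x : M.carrier // x ∉ MulAction.orbit (G × G) m}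
  left :=
    { smul := fun g x => ⟨g • x.1, by
        rw [left_smul_eq]; exact fun h => x.2 (mem_orbit_of_smul_mem h)⟩
      one_smul := fun x => Subtype.ext (one_smul G x.1)
      mul_smul := fun g h x => Subtype.ext (mul_smul g h x.1) }
  right :=
    { smul := fun g x => ⟨g • x.1, by
        rw [← MulOpposite.op_unop g, right_smul_eq]
        exact fun h => x.2 (mem_orbit_of_smul_mem h)⟩
      one_smul := fun x => Subtype.ext (one_smul Gᵐᵒᵖ x.1)
      mul_smul := fun g h x => Subtype.ext (mul_smul g h x.1) }
  comm := @SMulCommClass.mk _ _ _ (_) (_) fun g h x => Subtype.ext (smul_comm g h x.1)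

open Classical in
theorem exists_iso_disjUnion_orbitCompl (M : Biset G) (m : M.carrier) :
    Nonempty (Iso (disjUnion (ofSubgroup (stab M m)) (orbitCompl M m)) M) := by
  let e : (G × G) ⧸ stab M m ⊕ {x : M.carrier // x ∉ MulAction.orbit (G × G) m} ≃ M.carrier :=
    ((MulAction.orbitEquivQuotientStabilizer (G × G) m).symm.sumCongr (Equiv.refl _)).trans
      (Equiv.sumCompl fun x => x ∈ MulAction.orbit (G × G) m)
  refine ⟨isoOfEquiv (M := disjUnion (ofSubgroup (stab M m)) (orbitCompl M m)) e ?_⟩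
  rintro q (x | x)
  · induction x using QuotientGroup.induction_on with | _ x =>
    change ((MulAction.orbitEquivQuotientStabilizer (G × G) m).symm
      (q • (show (ofSubgroup (stab M m)).carrier from
        ((x : G × G) : (G × G) ⧸ stab M m))) : M.carrier) =
      q • ((MulAction.orbitEquivQuotientStabilizer (G × G) m).symm
        ((x : G × G) : (G × G) ⧸ stab M m) : M.carrier)
    rw [ofSubgroup_prod_smul, MulAction.orbitEquivQuotientStabilizer_symm_apply,
      MulAction.orbitEquivQuotientStabilizer_symm_apply, mul_smul]
  · rfl

/-- The classes of transitive bisets span the double Burnside algebra. -/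
theorem span_cls_ofSubgroup :
    Submodule.span R (Set.range fun U : Subgroup (G × G) => cls R (ofSubgroup U)) = ⊤ := by
  rw [eq_top_iff, ← span_cls R, Submodule.span_le]
  rintro _ ⟨M, rfl⟩
  induction hn : Nat.card M.carrier using Nat.strong_induction_on generalizing M with
  | _ n ih =>
    subst hn
    cases isEmpty_or_nonempty M.carrier with
    | inl h =>
      have e : Iso (disjUnion M M) M :=
        { toFun := Sum.elim id id
          invFun := Sum.inl
          left_inv := by rintro (x | x) <;> exact h.elim x
          right_inv := fun x => h.elim x
          map_left := fun g => by rintro (x | x) <;> exact h.elim x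
          map_right := fun g => by rintro (x | x) <;> exact h.elim x }
      have h0 := cls_iso R e
      rw [cls_disjUnion, add_eq_left] at h0
      rw [h0]
      exact zero_mem _
    | inr h =>
      obtain ⟨m⟩ := h
      obtain ⟨e⟩ := exists_iso_disjUnion_orbitCompl M m
      rw [← cls_iso R e, cls_disjUnion]
      refine add_mem (Submodule.subset_span ⟨_, rfl⟩) (ih _ ?_ _ rfl)
      let := Fintype.ofFinite M.carrier
      refine Finite.card_subtype_lt (p := fun x => x ∉ MulAction.orbit (G × G) m) (x := m) ?_
      simp

end Ghost

/-! ## The Mackey formula -/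

section Mackey

variable {G : Type} [Group G] {X : Type*} [AddCommGroup X]

theorem sum_quotient {Γ : Type*} [Group Γ] [Fintype Γ] (U : Subgroup Γ) [Fintype (Γ ⧸ U)]
    (f : Γ ⧸ U → X) : ∑ x : Γ, f x = Nat.card U • ∑ q, f q := by
  classical
  have : Fintype U := Fintype.ofFinite U
  have h : ∀ x : Γ, f x = (fun p : (Γ ⧸ U) × U => f p.1) (U.groupEquivQuotientProdSubgroup x) :=
    fun x => rfl
  simp_rw [h]
  rw [Equiv.sum_comp U.groupEquivQuotientProdSubgroup (fun p : (Γ ⧸ U) × U => f p.1),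
    Fintype.sum_prod_type]
  simp [Finset.smul_sum]

theorem link_stab {M N : Biset G} (m : M.carrier) (n : N.carrier) :
    link (stab M m) (stab N n) = Nat.card {g : G // op g⁻¹ • m = m ∧ g • n = n} := by
  refine Nat.card_congr (Equiv.subtypeEquivRight fun y => ?_)
  rw [mem_stab, mem_stab, right_smul_eq, left_smul_eq, inv_inv]

theorem card_transporter {M N : Biset G} (m m' : M.carrier) (n n' : N.carrier)
    (h : (tmk m n : TensorSet M N) = tmk m' n') :
    Nat.card {g : G // op g⁻¹ • m = m' ∧ g • n = n'} = link (stab M m') (stab N n') := by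
  obtain ⟨g, rfl, rfl⟩ := (tmk_eq_iff _ _ _ _).1 h
  rw [link_stab]
  refine Nat.card_congr ((Equiv.mulRight g⁻¹).subtypeEquiv fun y => ?_)
  simp only [Equiv.coe_mulRight, smul_smul, ← MulOpposite.op_mul]
  simp

variable [Fintype G]

open Classical in
/-- The pairs in a fibre of `M × N → M ×_G N`, weighted by `link`, count the elements of `G`. -/
theorem sum_link (M N : Biset G) [Fintype M.carrier] [Fintype N.carrier] (x : TensorSet M N) :
    ∑ p : M.carrier × N.carrier,
      (if tmk p.1 p.2 = x then link (stab M p.1) (stab N p.2) else 0) = Nat.card G := by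
  obtain ⟨m, n, rfl⟩ := tmk_surj x
  rw [Nat.card_eq_fintype_card, ← Finset.card_univ, Finset.card_eq_sum_card_fiberwise
    (f := fun g : G => (op g⁻¹ • m, g • n)) (t := Finset.univ) (fun _ _ => Finset.mem_univ _)]
  refine Finset.sum_congr rfl fun p _ => ?_
  split_ifs with h
  · rw [← card_transporter m p.1 n p.2 h.symm, Nat.card_eq_fintype_card, Fintype.card_subtype]
    simp [Prod.ext_iff]
  · symm
    rw [Finset.card_eq_zero, Finset.filter_eq_empty_iff]
    rintro g - rfl
    exact h ((tmk_eq_iff _ _ _ _).2 ⟨g, rfl, rfl⟩).symm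

theorem card_smul_stabSum_tensor (F : Subgroup (G × G) → X) (M N : Biset G)
    [Fintype M.carrier] [Fintype N.carrier] :
    Nat.card G • stabSum F (tensor M N) = ∑ m : M.carrier, ∑ n : N.carrier,
      link (stab M m) (stab N n) • F (star (stab M m) (stab N n)) := by
  classical
  let : Fintype (TensorSet M N) := Fintype.ofFinite _
  let : Fintype (tensor M N).carrier := inferInstanceAs (Fintype (TensorSet M N))
  have h : stabSum F (tensor M N) = ∑ x : TensorSet M N, F (stab (tensor M N) x) :=
    finsum_eq_sum_of_fintype _
  rw [h, Finset.smul_sum, ← Fintype.sum_prod_type'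
    (f := fun m n => link (stab M m) (stab N n) • F (star (stab M m) (stab N n)))]
  calc _ = ∑ x : TensorSet M N, ∑ p : M.carrier × N.carrier,
        (if tmk p.1 p.2 = x then link (stab M p.1) (stab N p.2) else 0) •
          F (stab (tensor M N) x) := by
        refine Finset.sum_congr rfl fun x _ => ?_
        rw [← Finset.sum_smul, sum_link]
    _ = _ := by
        rw [Finset.sum_comm]
        refine Finset.sum_congr rfl fun p _ => ?_
        simp only [ite_smul, zero_smul, Finset.sum_ite_eq, Finset.mem_univ, if_true, stab_tmk]

theorem card_smul_stabSum_ofSubgroup {F : Subgroup (G × G) → X}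
    (hF : ∀ h S g, F (twist h S g) = F S) (U : Subgroup (G × G)) :
    Nat.card U • stabSum F (ofSubgroup U) = Nat.card G ^ 2 • F U := by
  classical
  let : Fintype ((G × G) ⧸ U) := Fintype.ofFinite _
  let : Fintype (ofSubgroup U).carrier := inferInstanceAs (Fintype ((G × G) ⧸ U))
  have h : stabSum F (ofSubgroup U) = ∑ x : (G × G) ⧸ U, F (stab (ofSubgroup U) x) :=
    finsum_eq_sum_of_fintype _
  rw [h, ← sum_quotient U fun x => F (stab (ofSubgroup U) x)]
  simp_rw [stab_ofSubgroup, hF]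
  simp [sq]

/-- The Mackey formula for the product of two transitive bisets. -/
theorem card_smul_stabSum_tensor_ofSubgroup {F : Subgroup (G × G) → X}
    (hF : ∀ h S g, F (twist h S g) = F S) (U V : Subgroup (G × G)) :
    (Nat.card U * Nat.card V * Nat.card G) • stabSum F (tensor (ofSubgroup U) (ofSubgroup V)) =
      Nat.card G ^ 3 • ∑ g : G, link (twist 1 U g) V • F (star (twist 1 U g) V) := by
  classical
  let : Fintype ((G × G) ⧸ U) := Fintype.ofFinite _
  let : Fintype ((G × G) ⧸ V) := Fintype.ofFinite _
  let : Fintype (ofSubgroup U).carrier := inferInstanceAs (Fintype ((G × G) ⧸ U))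
  let : Fintype (ofSubgroup V).carrier := inferInstanceAs (Fintype ((G × G) ⧸ V))
  let Φ : Subgroup (G × G) → Subgroup (G × G) → X := fun S T => link S T • F (star S T)
  have hΦ (h k S T g l) : Φ (twist h S g) (twist k T l) = Φ (twist 1 S (k * g)) T := by
    simp only [Φ, star_twist, link_twist, hF]
  rw [mul_smul, card_smul_stabSum_tensor]
  change (Nat.card U * Nat.card V) • (∑ m : (G × G) ⧸ U, ∑ n : (G × G) ⧸ V,
    Φ (stab (ofSubgroup U) m) (stab (ofSubgroup V) n)) = Nat.card G ^ 3 • ∑ g, Φ (twist 1 U g) V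
  calc _ = ∑ x : G × G, ∑ y : G × G, Φ (twist 1 U (y.1⁻¹ * x.2)) V := by
        rw [mul_smul, Finset.smul_sum]
        simp_rw [← sum_quotient V fun n => Φ _ (stab (ofSubgroup V) n)]
        rw [← sum_quotient U fun m => ∑ y : G × G,
          Φ (stab (ofSubgroup U) m) (stab (ofSubgroup V) ((y : G × G) : (G × G) ⧸ V))]
        simp_rw [stab_ofSubgroup, hΦ]
    _ = ∑ x : G × G, Nat.card G • ∑ g, Φ (twist 1 U g) V := by
        refine Finset.sum_congr rfl fun x _ => ?_
        rw [Fintype.sum_prod_type]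
        simp only [Finset.sum_const, Finset.card_univ, ← Nat.card_eq_fintype_card,
          ← Finset.smul_sum]
        congr 1
        exact Equiv.sum_comp ((Equiv.inv G).trans (Equiv.mulRight x.2))
          fun g => Φ (twist 1 U g) V
    _ = _ := by
        rw [Finset.sum_const, Finset.card_univ, ← Nat.card_eq_fintype_card, smul_smul,
          Nat.card_prod]
        congr 1
        ring

end Mackey

/-! ## Subgroups of `S₃ × S₃` as bit masks

The elements of `S₃` are numbered by `b ^ r * a ^ ε ↦ r + 3 ε`, pairs of elements by
`(i, j) ↦ 6 i + j`, and a set of pairs is recorded as the natural number with these bits. -/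

/-- Multiplication of `S₃` in the numbering `b ^ r * a ^ ε ↦ r + 3 ε`. -/
def codeMul (i j : ℕ) : ℕ := (i % 3 + (1 + i / 3) * j) % 3 + 3 * ((i / 3 + j / 3) % 2)

/-- `f n`, arranged so that evaluation by the kernel reduces `n` to a literal first. -/
def force {α : Type} (n : ℕ) (f : ℕ → α) : α :=
  match n with
  | 0 => f 0
  | k + 1 => f (k + 1)

/-- Multiplication of pairs by their numbers. -/
def pairMul (k l : ℕ) : ℕ := 6 * codeMul (k / 6) (l / 6) + codeMul (k % 6) (l % 6)

/-- The `i`-th row of a relation, in the lowest six bits. -/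
def row (m i : ℕ) : ℕ := m >>> (6 * i)

/-- The union of the rows of `n` that are selected by the bits of `r`. -/
def rowStar (r n : ℕ) : ℕ :=
  (bif r.testBit 0 then row n 0 % 64 else 0) ||| (bif r.testBit 1 then row n 1 % 64 else 0) |||
  (bif r.testBit 2 then row n 2 % 64 else 0) ||| (bif r.testBit 3 then row n 3 % 64 else 0) |||
  (bif r.testBit 4 then row n 4 % 64 else 0) ||| (bif r.testBit 5 then row n 5 % 64 else 0)

/-- Composition of relations, given by bit masks. -/
def maskStar (m n : ℕ) : ℕ :=
  rowStar (row m 0) n ||| rowStar (row m 1) n <<< 6 ||| rowStar (row m 2) n <<< 12 |||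
  rowStar (row m 3) n <<< 18 ||| rowStar (row m 4) n <<< 24 ||| rowStar (row m 5) n <<< 30

/-- The contribution of the element with number `y` to `maskLink m n`. -/
def linkBit (m n y : ℕ) : ℕ := bif m.testBit y && n.testBit (6 * y) then 1 else 0

/-- The value of `link`, computed from bit masks. -/
def maskLink (m n : ℕ) : ℕ :=
  linkBit m n 0 + linkBit m n 1 + linkBit m n 2 + linkBit m n 3 + linkBit m n 4 + linkBit m n 5

/-- Adds the products of `k` with the generators to the mask `m` and to the list of elements
still to be treated, and passes both on to `cont`. -/
def growStep (k : ℕ) : List ℕ → List ℕ → ℕ → (List ℕ → ℕ → ℕ) → ℕ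
  | [], todo, m, cont => cont todo m
  | g :: gens, todo, m, cont =>
    force (pairMul k g) fun x =>
      bif m.testBit x then growStep k gens todo m cont
      else force (m ||| 1 <<< x) fun m' => growStep k gens (x :: todo) m' cont

/-- Breadth-first generation of a subgroup, with at most the given number of steps. -/
def grow (gens : List ℕ) : ℕ → List ℕ → ℕ → ℕ
  | 0, _, m => m
  | _ + 1, [], m => m
  | f + 1, k :: todo, m => growStep k gens todo m (grow gens f)

/-- The mask of the subgroup generated by the elements with the given numbers. -/
def closureMask (gens : List ℕ) : ℕ := grow gens 37 [0] 1

/-- The masks of representatives of the conjugacy classes of subgroups of `S₃ × S₃`. -/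
def repMasks : List ℕ :=
  [1, 262145, 9, 2097153, 4161, 7, 16513, 2359305, 1090785345, 63, 14680071, 37449, 1835015,
   8726253633, 34630287489, 29127, 16515135, 9817068105, 262143, 7635497415, 61083775431,
   68719476735]

def repMask (i : ℕ) : ℕ := repMasks.getD i 0
/-- The orders of the representatives. -/
def repCards : List ℕ :=
  [1, 2, 2, 2, 3, 3, 3, 4, 6, 6, 6, 6, 6, 6, 6, 9, 12, 12, 18, 18, 18, 36]

def repCard (i : ℕ) : ℕ := repCards.getD i 0
/-- Generators of the representatives. -/
def repGens : List (List ℕ) :=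
  [[], [18], [3], [21], [6], [1], [7], [18, 3], [18, 6], [3, 1], [21, 1], [6, 3], [18, 1], [21,
   6], [21, 7], [6, 1], [18, 3, 1], [18, 6, 3], [6, 3, 1], [18, 6, 1], [21, 6, 1], [18, 6, 3, 1]]

def repGen (i : ℕ) : List ℕ := repGens.getD i []
/-- The masks of the graphs of the inner automorphisms. -/
def innerMasks : List ℕ :=
  [34630287489, 17322492033, 9131016321, 17718845697, 8866767105, 34498158849]

def innerMask (i : ℕ) : ℕ := innerMasks.getD i 0
/-- The masks of all subgroups of `S₃ × S₃`, each with the number of its conjugacy class and a pair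
of elements that conjugates the representative to it. -/
def subgroupTable : List (ℕ × ℕ × ℕ × ℕ) :=
  [(1, 0, 0, 0), (262145, 1, 0, 0), (1073741825, 1, 2, 0), (16777217, 1, 1, 0), (9, 2, 0, 0), (33,
   2, 0, 1), (17, 2, 0, 2), (2097153, 3, 0, 0), (8388609, 3, 0, 1), (4194305, 3, 0, 2),
   (8589934593, 3, 2, 0), (34359738369, 3, 2, 1), (17179869185, 3, 2, 2), (134217729, 3, 1, 0),
   (536870913, 3, 1, 1), (268435457, 3, 1, 2), (4161, 4, 0, 0), (7, 5, 0, 0), (16513, 6, 0, 0),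
   (8449, 6, 0, 3), (2359305, 7, 0, 0), (8650785, 7, 0, 1), (4456465, 7, 0, 2), (9663676425, 7, 2,
   0), (35433480225, 7, 2, 1), (18253611025, 7, 2, 2), (150994953, 7, 1, 0), (553648161, 7, 1, 1),
   (285212689, 7, 1, 2), (1090785345, 8, 0, 0), (63, 9, 0, 0), (14680071, 10, 0, 0), (60129542151,
   10, 2, 0), (939524103, 10, 1, 0), (37449, 11, 0, 0), (137313, 11, 0, 1), (70737, 11, 0, 2),
   (1835015, 12, 0, 0), (7516192775, 12, 2, 0), (117440519, 12, 1, 0), (8726253633, 13, 0, 0),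
   (34905002049, 13, 0, 1), (17452503105, 13, 0, 2), (34630287489, 14, 0, 0), (17322492033, 14, 0,
   1), (9131016321, 14, 0, 2), (17718845697, 14, 0, 3), (8866767105, 14, 0, 4), (34498158849, 14,
   0, 5), (29127, 15, 0, 0), (16515135, 16, 0, 0), (67645734975, 16, 2, 0), (1056964671, 16, 1,
   0), (9817068105, 17, 0, 0), (35995916385, 17, 0, 1), (18543350865, 17, 0, 2), (262143, 18, 0,
   0), (7635497415, 19, 0, 0), (61083775431, 20, 0, 0), (68719476735, 21, 0, 0)]

/-- The entry of a mask in a table of the shape of `subgroupTable`. -/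
def typeLookup : List (ℕ × ℕ × ℕ × ℕ) → ℕ → ℕ × ℕ × ℕ
  | [], _ => (22, 0, 0)
  | x :: l, m => bif Nat.beq x.1 m then x.2 else typeLookup l m
/-- The number of the conjugacy class of a subgroup, given by its mask. -/
def maskType (m : ℕ) : ℕ := (typeLookup subgroupTable m).1

/-- The coordinates in `A` of the images of the classes of `(S₃ × S₃) / U`, with `U` running
through the representatives. -/
def imageRows : List (List ℤ) := [
    [0, -5, 0, 0, 6, 0, 0, -42, 0, 0, 0, 0, 0, 0, 0, 0, 252, 0, 0, 0, 0, 0],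
    [0, -2, 0, 0, 3, 0, 0, -20, 0, 0, 0, 0, 0, 0, 0, 0, 120, 0, 0, 0, 0, 0],
    [15, -60, -10, -18, 72, 12, 126, -504, -84, -10, 12, -84, 0, 0, 0, -756, 3024, 504, 0, 0, 504, 0],
    [-3, 9, 2, 0, 3, 0, -6, 2, 4, 2, 0, 4, 1, 0, 0, 36, -12, -24, 0, 0, -24, 0],
    [0, -3, 0, 0, 2, 0, 0, -16, 0, 0, 0, 0, 0, 0, 0, 0, 96, 0, 0, 0, 0, 0],
    [20, -55, -10, -24, 66, 12, 168, -462, -84, -10, 12, -84, 0, 0, 0, -1008, 2772, 504, 0, 0, 504, 0],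
    [8, -23, -4, 0, 2, 0, 12, -46, -6, -4, 0, -6, 0, 0, 2, -72, 276, 36, 0, 0, 36, 0],
    [6, -24, -4, -9, 36, 6, 60, -240, -40, -4, 6, -40, 0, 0, 0, -360, 1440, 240, 0, 0, 240, 0],
    [0, -1, 0, 0, 1, 0, 0, -7, 0, 0, 0, 0, 0, 0, 0, 0, 36, 0, 0, 0, 0, 0],
    [25, -85, -15, -30, 102, 18, 210, -714, -126, -10, 12, -84, 0, 0, 0, -1260, 4284, 756, 0, 0, 504, 0],
    [7, -16, -3, -12, 33, 6, 78, -208, -38, -4, 6, -40, 1, -2, 0, -468, 1248, 228, 0, 0, 240, 0],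
    [9, -36, -6, -6, 24, 4, 48, -192, -32, -6, 4, -32, 0, 0, 0, -288, 1152, 192, 0, 0, 192, 0],
    [8, -22, -4, -12, 33, 6, 80, -220, -40, -4, 6, -40, 0, 0, 0, -480, 1320, 240, 0, 0, 240, 0],
    [-3, 10, 2, 0, 1, 0, -6, 15, 4, 2, 0, 4, 1, 0, 0, 72, -228, -48, -2, 0, -48, 0],
    [1, 0, 0, 0, 1, 0, 0, 0, 1, 0, 0, 0, 1, 0, 1, 0, 0, 0, 0, 1, 0, 0],
    [12, -33, -6, -8, 22, 4, 64, -176, -32, -6, 4, -32, 0, 0, 0, -384, 1056, 192, 0, 0, 192, 0],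
    [10, -34, -6, -15, 51, 9, 100, -340, -60, -4, 6, -40, 0, 0, 0, -600, 2040, 360, 0, 0, 240, 0],
    [3, -12, -2, -3, 12, 2, 21, -84, -14, -2, 2, -14, 0, 0, 0, -108, 432, 72, 0, 0, 72, 0],
    [15, -51, -9, -10, 34, 6, 80, -272, -48, -6, 4, -32, 0, 0, 0, -480, 1632, 288, 0, 0, 192, 0],
    [4, -11, -2, -4, 11, 2, 28, -77, -14, -2, 2, -14, 0, 0, 0, -144, 396, 72, 0, 0, 72, 0],
    [3, -5, -1, -4, 11, 2, 26, -65, -12, -2, 2, -14, 1, -2, 0, -120, 252, 48, -2, 0, 24, 4],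
    [5, -17, -3, -5, 17, 3, 35, -119, -21, -2, 2, -14, 0, 0, 0, -180, 612, 108, 0, 0, 72, 0]]

def imageRow (i k : ℕ) : ℤ := (imageRows.getD i []).getD k 0

/-- The multiplication of `A` in coordinates. -/
def mulCoord (p q : ℕ → ℤ) : List ℤ :=
  [p 0 * q 0 + p 1 * q 3 + p 2 * q 6, p 0 * q 1 + p 1 * q 4 + p 2 * q 7,
   p 0 * q 2 + p 1 * q 5 + p 2 * q 8, p 3 * q 0 + p 4 * q 3 + p 5 * q 6,
   p 3 * q 1 + p 4 * q 4 + p 5 * q 7, p 3 * q 2 + p 4 * q 5 + p 5 * q 8,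
   p 6 * q 0 + p 7 * q 3 + p 8 * q 6, p 6 * q 1 + p 7 * q 4 + p 8 * q 7,
   p 6 * q 2 + p 7 * q 5 + p 8 * q 8,
   p 0 * q 9 + p 1 * q 10 + p 2 * q 11 + p 9 * q 19,
   p 3 * q 9 + p 4 * q 10 + p 5 * q 11 + p 10 * q 19,
   p 6 * q 9 + p 7 * q 10 + p 8 * q 11 + p 11 * q 19,
   p 12 * q 12, p 12 * q 13 + p 13 * q 19, p 14 * q 14,
   p 15 * q 0 + p 16 * q 3 + p 17 * q 6 + p 19 * q 15,
   p 15 * q 1 + p 16 * q 4 + p 17 * q 7 + p 19 * q 16,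
   p 15 * q 2 + p 16 * q 5 + p 17 * q 8 + p 19 * q 17,
   p 18 * q 12 + p 19 * q 18,
   p 19 * q 19,
   p 15 * q 9 + p 16 * q 10 + p 17 * q 11 - 12 * (p 18 * q 13) + p 19 * q 20 + p 20 * q 19,
   p 18 * q 13 + p 19 * q 21 + p 21 * q 19]

/-- The mask of a conjugate subgroup. -/
def conjMask (h m g : ℕ) : ℕ := maskStar (maskStar (innerMask h) m) (innerMask g)

/-- The class and the weight of a term of the Mackey formula. -/
def mackeyTerm (m n g : ℕ) : ℕ × ℕ :=
  let r := maskStar m (innerMask g)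
  let t := maskType (maskStar r n)
  (t, maskLink r n * repCard t)

/-- `cont (l.map (mackeyTerm m n))`, evaluated eagerly. -/
def mackeyTerms (m n : ℕ) : List ℕ → (List (ℕ × ℕ) → Bool) → Bool
  | [], cont => cont []
  | g :: l, cont =>
    force (maskStar m (innerMask g)) fun r => force (maskType (maskStar r n)) fun t =>
      force (maskLink r n * repCard t) fun w => mackeyTerms m n l fun ts => cont ((t, w) :: ts)

/-- The `k`-th coordinate of a sum of weighted images. -/
def termSum (k : ℕ) (ts : List (ℕ × ℕ)) : ℤ := (ts.map fun x => (x.2 : ℤ) * imageRow x.1 k).sum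

/-- The images of two classes multiply as the Mackey formula says. -/
def mulCheck (i j : ℕ) : Bool :=
  force (repCard i * repCard j) fun c =>
    mackeyTerms (repMask i) (repMask j) (List.range 6) fun ts => (List.range 22).all fun k =>
      decide (termSum k ts = (c : ℤ) * (mulCoord (imageRow i) (imageRow j)).getD k 0)

/-- A conjugate of a representative has the expected class. -/
def typeCheck (i h g : ℕ) : Bool := Nat.beq (maskType (conjMask h (repMask i) g)) i

/-- A representative together with a further element generates a larger listed subgroup. -/
def closureCheck (i s : ℕ) : Bool :=
  (repMask i).testBit s || force (closureMask (s :: repGen i)) fun m =>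
    let w := typeLookup subgroupTable m
    Nat.beq (conjMask w.2.1 (repMask w.1) w.2.2) m && Nat.blt w.1 22 &&
      Nat.blt w.2.1 6 && Nat.blt w.2.2 6 && Nat.blt (repCard i) (repCard w.1)

set_option maxRecDepth 100000 in
theorem mulCheck_all : ((List.range 22).all fun i => (List.range 22).all fun j =>
    mulCheck i j) = true := by
  decide +kernel

set_option maxRecDepth 100000 in
theorem typeCheck_all : ((List.range 22).all fun i => (List.range 6).all fun h =>
    (List.range 6).all fun g => typeCheck i h g) = true := by
  decide +kernel

set_option maxRecDepth 100000 in
theorem closureCheck_all : ((List.range 22).all fun i => (List.range 36).all fun s =>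
    closureCheck i s) = true := by
  decide +kernel

/-! ### Correctness of the bit masks -/

theorem force_eq {α : Type} (n : ℕ) (f : ℕ → α) : force n f = f n := by cases n <;> rfl

/-- The element of `S₃` with number `i`. -/
def el (i : ℕ) : S3 := b ^ (i % 3) * a ^ (i / 3)

/-- The pair with number `k`. -/
def elPair (k : ℕ) : S3 × S3 := (el (k / 6), el (k % 6))

theorem codeMul_lt (i j : ℕ) : codeMul i j < 6 := by
  unfold codeMul; omega

theorem pairMul_lt (k l : ℕ) : pairMul k l < 36 := by
  have := codeMul_lt (k / 6) (l / 6)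
  have := codeMul_lt (k % 6) (l % 6)
  unfold pairMul; omega

theorem el_codeMul {i j : ℕ} (hi : i < 6) (hj : j < 6) : el (codeMul i j) = el i * el j := by
  have h : ∀ i < 6, ∀ j < 6, el (codeMul i j) = el i * el j := by decide
  exact h i hi j hj

theorem exists_el (x : S3) : ∃ i < 6, el i = x := by
  have h : ∀ x : S3, ∃ i < 6, el i = x := by decide
  exact h x

theorem el_injective {i j : ℕ} (hi : i < 6) (hj : j < 6) (h : el i = el j) : i = j := by
  have h' : ∀ i < 6, ∀ j < 6, el i = el j → i = j := by decide
  exact h' i hi j hj h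

theorem elPair_pairMul {k l : ℕ} (hk : k < 36) (hl : l < 36) :
    elPair (pairMul k l) = elPair k * elPair l := by
  have h1 := codeMul_lt (k / 6) (l / 6)
  have h2 := codeMul_lt (k % 6) (l % 6)
  have e1 : pairMul k l / 6 = codeMul (k / 6) (l / 6) := by unfold pairMul; omega
  have e2 : pairMul k l % 6 = codeMul (k % 6) (l % 6) := by unfold pairMul; omega
  rw [elPair, e1, e2, el_codeMul (by omega) (by omega), el_codeMul (by omega) (by omega)]
  rfl

theorem elPair_eq (i j : ℕ) (hj : j < 6) : elPair (6 * i + j) = (el i, el j) := by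
  rw [elPair, show (6 * i + j) / 6 = i by omega, show (6 * i + j) % 6 = j by omega]

/-- The bits of `m` are the elements of `S`. -/
def Represents (m : ℕ) (S : Subgroup (S3 × S3)) : Prop :=
  m < 2 ^ 36 ∧ ∀ i < 6, ∀ j < 6, m.testBit (6 * i + j) = true ↔ (el i, el j) ∈ S

theorem Represents.testBit_iff {m : ℕ} {S : Subgroup (S3 × S3)} (h : Represents m S) {k : ℕ}
    (hk : k < 36) : m.testBit k = true ↔ elPair k ∈ S := by
  have := h.2 (k / 6) (by omega) (k % 6) (by omega)
  rwa [Nat.div_add_mod] at this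

theorem Represents.mask_eq {m n : ℕ} {S : Subgroup (S3 × S3)} (hm : Represents m S)
    (hn : Represents n S) : m = n := by
  refine Nat.eq_of_testBit_eq fun k => ?_
  by_cases hk : k < 36
  · rw [Bool.eq_iff_iff, hm.testBit_iff hk, hn.testBit_iff hk]
  · have h : 2 ^ 36 ≤ 2 ^ k := Nat.pow_le_pow_right (by norm_num) (by omega)
    rw [Nat.testBit_lt_two_pow (hm.1.trans_le h), Nat.testBit_lt_two_pow (hn.1.trans_le h)]

theorem exists_elPair (q : S3 × S3) : ∃ k < 36, elPair k = q := by
  obtain ⟨x, y⟩ := q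
  obtain ⟨i, hi, rfl⟩ := exists_el x
  obtain ⟨j, hj, rfl⟩ := exists_el y
  exact ⟨6 * i + j, by omega, elPair_eq i j hj⟩

theorem testBit_rowStar (r n : ℕ) {j : ℕ} (hj : j < 6) :
    (rowStar r n).testBit j = true ↔
      ∃ y < 6, r.testBit y = true ∧ n.testBit (6 * y + j) = true := by
  have h (y : ℕ) : (bif r.testBit y then row n y % 64 else 0).testBit j =
      (r.testBit y && n.testBit (6 * y + j)) := by
    cases r.testBit y
    · simp
    · change (row n y % 2 ^ 6).testBit j = _
      rw [Nat.testBit_mod_two_pow, row, Nat.testBit_shiftRight]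
      simp [hj]
  simp only [rowStar, Nat.testBit_or, h, Bool.or_eq_true, Bool.and_eq_true]
  constructor
  · rintro (((((h | h) | h) | h) | h) | h)
    exacts [⟨0, by norm_num, h⟩, ⟨1, by norm_num, h⟩, ⟨2, by norm_num, h⟩, ⟨3, by norm_num, h⟩,
      ⟨4, by norm_num, h⟩, ⟨5, by norm_num, h⟩]
  · rintro ⟨y, hy, h⟩
    interval_cases y <;> tauto

theorem rowStar_lt (r n : ℕ) : rowStar r n < 2 ^ 6 := by
  have h (y : ℕ) : (bif r.testBit y then row n y % 64 else 0) < 2 ^ 6 := by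
    cases r.testBit y
    · simp
    · exact Nat.mod_lt _ (by norm_num)
  exact Nat.or_lt_two_pow (Nat.or_lt_two_pow (Nat.or_lt_two_pow (Nat.or_lt_two_pow
    (Nat.or_lt_two_pow (h 0) (h 1)) (h 2)) (h 3)) (h 4)) (h 5)

theorem testBit_maskStar (m n : ℕ) {i j : ℕ} (hi : i < 6) (hj : j < 6) :
    (maskStar m n).testBit (6 * i + j) = (rowStar (row m i) n).testBit j := by
  have hz (r k : ℕ) (hk : 6 ≤ k) : (rowStar r n).testBit k = false :=
    Nat.testBit_lt_two_pow ((rowStar_lt r n).trans_le (Nat.pow_le_pow_right (by norm_num) hk))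
  simp only [maskStar, Nat.testBit_or, Nat.testBit_shiftLeft]
  interval_cases i <;> interval_cases j <;> simp [hz]

theorem maskStar_lt (m n : ℕ) : maskStar m n < 2 ^ 36 := by
  have h (r k : ℕ) (hk : k ≤ 30) : rowStar r n <<< k < 2 ^ 36 := by
    rw [Nat.shiftLeft_eq]
    calc _ < 2 ^ 6 * 2 ^ k := Nat.mul_lt_mul_of_pos_right (rowStar_lt r n) (by positivity)
      _ ≤ 2 ^ 6 * 2 ^ 30 := Nat.mul_le_mul_left _ (Nat.pow_le_pow_right (by norm_num) hk)
      _ = _ := by norm_num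
  refine Nat.or_lt_two_pow (Nat.or_lt_two_pow (Nat.or_lt_two_pow (Nat.or_lt_two_pow
    (Nat.or_lt_two_pow ?_ (h _ _ ?_)) (h _ _ ?_)) (h _ _ ?_)) (h _ _ ?_)) (h _ _ ?_)
  · exact (rowStar_lt _ n).trans (by norm_num)
  all_goals norm_num

theorem Represents.star {m n : ℕ} {S T : Subgroup (S3 × S3)} (hm : Represents m S)
    (hn : Represents n T) : Represents (maskStar m n) (star S T) := by
  refine ⟨maskStar_lt m n, fun i hi j hj => ?_⟩
  rw [testBit_maskStar m n hi hj, testBit_rowStar _ _ hj, mem_star]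
  have hr (y : ℕ) : (row m i).testBit y = m.testBit (6 * i + y) := by
    rw [row, Nat.testBit_shiftRight]
  constructor
  · rintro ⟨y, hy, h1, h2⟩
    rw [hr] at h1
    exact ⟨el y, (hm.2 i hi y hy).1 h1, (hn.2 y hy j hj).1 h2⟩
  · rintro ⟨x, h1, h2⟩
    obtain ⟨y, hy, rfl⟩ := exists_el x
    exact ⟨y, hy, (hr y).trans ((hm.2 i hi y hy).2 h1), (hn.2 y hy j hj).2 h2⟩

/-- The graph of the inner automorphism given by `x`. -/
def innerGraph (x : S3) : Subgroup (S3 × S3) where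
  carrier := {q | x * q.1 * x⁻¹ = q.2}
  one_mem' := by simp
  mul_mem' := by
    intro p q hp hq
    change x * (p.1 * q.1) * x⁻¹ = p.2 * q.2
    rw [← show x * p.1 * x⁻¹ = p.2 from hp, ← show x * q.1 * x⁻¹ = q.2 from hq]
    group
  inv_mem' := by
    intro p hp
    change x * p.1⁻¹ * x⁻¹ = p.2⁻¹
    rw [← show x * p.1 * x⁻¹ = p.2 from hp]
    group

theorem star_innerGraph (h : S3) (S : Subgroup (S3 × S3)) (g : S3) :
    star (star (innerGraph h) S) (innerGraph g) = twist h S g := by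
  ext ⟨x, z⟩
  simp only [mem_star, mem_twist]
  constructor
  · rintro ⟨y, ⟨w, h1, h2⟩, h3⟩
    change h * x * h⁻¹ = w at h1
    change g * y * g⁻¹ = z at h3
    subst h1 h3
    simpa [mul_assoc] using h2
  · intro hm
    refine ⟨g⁻¹ * z * g, ⟨h * x * h⁻¹, rfl, hm⟩, ?_⟩
    change g * (g⁻¹ * z * g) * g⁻¹ = z
    group

theorem star_innerGraph_right (S : Subgroup (S3 × S3)) (g : S3) :
    star S (innerGraph g) = twist 1 S g := by
  ext ⟨x, z⟩
  simp only [mem_star, mem_twist]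
  constructor
  · rintro ⟨y, h2, h3⟩
    change g * y * g⁻¹ = z at h3
    subst h3
    simpa [mul_assoc] using h2
  · intro hm
    refine ⟨g⁻¹ * z * g, by simpa using hm, ?_⟩
    change g * (g⁻¹ * z * g) * g⁻¹ = z
    group

theorem represents_innerGraph {g : ℕ} (hg : g < 6) :
    Represents (innerMask g) (innerGraph (el g)) := by
  have h : ∀ g < 6, innerMask g < 2 ^ 36 ∧ ∀ i < 6, ∀ j < 6,
      (innerMask g).testBit (6 * i + j) = true ↔ el g * el i * (el g)⁻¹ = el j := by
    decide +kernel
  exact h g hg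

theorem Represents.twist {m : ℕ} {S : Subgroup (S3 × S3)} (hm : Represents m S) {h g : ℕ}
    (hh : h < 6) (hg : g < 6) : Represents (conjMask h m g) (twist (el h) S (el g)) := by
  rw [← star_innerGraph]
  exact ((represents_innerGraph hh).star hm).star (represents_innerGraph hg)

theorem Represents.twist_right {m : ℕ} {S : Subgroup (S3 × S3)} (hm : Represents m S) {g : ℕ}
    (hg : g < 6) : Represents (maskStar m (innerMask g)) (DBurnside.twist 1 S (el g)) := by
  rw [← star_innerGraph_right]
  exact hm.star (represents_innerGraph hg)

theorem el_bijOn : Function.Bijective fun i : Fin 6 => el i := by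
  refine ⟨fun i j h => Fin.ext (el_injective i.2 j.2 h), fun x => ?_⟩
  obtain ⟨i, hi, h⟩ := exists_el x
  exact ⟨⟨i, hi⟩, h⟩

theorem Represents.link {m n : ℕ} {S T : Subgroup (S3 × S3)} (hm : Represents m S)
    (hn : Represents n T) : link S T = maskLink m n := by
  have e : {y : S3 // ((1 : S3), y) ∈ S ∧ (y, (1 : S3)) ∈ T} ≃
      {i : Fin 6 // (m.testBit i && n.testBit (6 * i)) = true} := by
    refine ((Equiv.ofBijective _ el_bijOn).subtypeEquiv fun i => ?_).symm
    have h1 := hm.2 0 (by norm_num) i i.2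
    have h2 := hn.2 i i.2 0 (by norm_num)
    have h0 : el 0 = 1 := rfl
    rw [h0] at h1 h2
    simp only [mul_zero, zero_add, add_zero] at h1 h2
    rw [Bool.and_eq_true, h1, h2]
    rfl
  rw [DBurnside.link, Nat.card_congr e, Nat.card_eq_fintype_card, Fintype.card_subtype,
    Finset.card_filter, Fin.sum_univ_six]
  simp only [maskLink, linkBit, cond_eq_ite]
  rfl

/-! ### Generated subgroups -/

theorem growStep_induction {P : ℕ → Prop} {gens : List ℕ} {cont : List ℕ → ℕ → ℕ}
    (hcont : ∀ todo m, (∀ x ∈ todo, P x) → (∀ x, m.testBit x = true → P x) →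
      ∀ x, (cont todo m).testBit x = true → P x) (k : ℕ) (hg : ∀ x ∈ gens, P (pairMul k x)) :
    ∀ todo m, (∀ x ∈ todo, P x) → (∀ x, m.testBit x = true → P x) →
      ∀ x, (growStep k gens todo m cont).testBit x = true → P x := by
  induction gens with
  | nil => exact hcont
  | cons g gens ih =>
    intro todo m ht hm
    have hgk := hg g List.mem_cons_self
    have ih := ih fun x hx => hg x (List.mem_cons_of_mem _ hx)
    rw [growStep, force_eq, force_eq]
    cases m.testBit (pairMul k g)
    · refine ih _ _ (fun x hx => ?_) fun x hx => ?_
      · rcases List.mem_cons.1 hx with rfl | hx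
        exacts [hgk, ht x hx]
      · rw [Nat.testBit_or, Bool.or_eq_true, Nat.one_shiftLeft, Nat.testBit_two_pow] at hx
        rcases hx with hx | hx
        · exact hm x hx
        · rwa [← of_decide_eq_true hx]
    · exact ih _ _ ht hm

theorem grow_induction {P : ℕ → Prop} {gens : List ℕ}
    (hP : ∀ k, P k → ∀ x ∈ gens, P (pairMul k x)) (f : ℕ) :
    ∀ todo m, (∀ x ∈ todo, P x) → (∀ x, m.testBit x = true → P x) →
      ∀ x, (grow gens f todo m).testBit x = true → P x := by
  induction f with
  | zero => intro todo m _ hm; simpa [grow] using hm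
  | succ f ih =>
    intro todo m ht hm
    cases todo with
    | nil => simpa [grow] using hm
    | cons k todo =>
      exact growStep_induction ih k (hP k (ht k List.mem_cons_self)) todo m
        (fun x hx => ht x (List.mem_cons_of_mem _ hx)) hm

theorem elPair_mem_of_testBit_closureMask {gens : List ℕ} {S : Subgroup (S3 × S3)}
    (h : ∀ x ∈ gens, x < 36 ∧ elPair x ∈ S) {k : ℕ} (hk : (closureMask gens).testBit k = true) :
    elPair k ∈ S := by
  have h0 : elPair 0 = 1 := rfl
  refine (grow_induction (P := fun k => k < 36 ∧ elPair k ∈ S) (gens := gens)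
    (fun k hk x hx => ⟨pairMul_lt _ _, ?_⟩) 37 [0] 1 ?_ ?_ k hk).2
  · rw [elPair_pairMul hk.1 (h x hx).1]
    exact S.mul_mem hk.2 (h x hx).2
  · simp [h0, S.one_mem]
  · intro x hx
    rw [Nat.testBit_one_eq_true_iff_self_eq_zero] at hx
    subst hx
    simp [h0, S.one_mem]

/-! ## Conjugacy classes of subgroups of `S₃ × S₃` -/

/-- Representatives of the conjugacy classes of subgroups of `S₃ × S₃`. -/
def rep : ℕ → Subgroup (S3 × S3)
  | 0 => V0.prod V0
  | 1 => V1.prod V0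
  | 2 => V0.prod V1
  | 3 => Subgroup.closure {(a, a)}
  | 4 => V4.prod V0
  | 5 => V0.prod V4
  | 6 => Subgroup.closure {(b, b)}
  | 7 => V1.prod V1
  | 8 => V5.prod V0
  | 9 => V0.prod V5
  | 10 => Subgroup.closure {(a, a), (1, b)}
  | 11 => V4.prod V1
  | 12 => V1.prod V4
  | 13 => Subgroup.closure {(a, a), (b, 1)}
  | 14 => Subgroup.closure {(a, a), (b, b)}
  | 15 => V4.prod V4
  | 16 => V1.prod V5
  | 17 => V5.prod V1
  | 18 => V4.prod V5
  | 19 => V5.prod V4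
  | 20 => Subgroup.closure {(a, a), (b, 1), (1, b)}
  | _ => V5.prod V5

theorem el_mem_V0 {i : ℕ} (hi : i < 6) : el i ∈ V0 ↔ Nat.testBit 1 i = true := by
  have h : ∀ i < 6, el i = 1 ↔ Nat.testBit 1 i = true := by decide
  exact h i hi

theorem mem_V1 {x : S3} : x ∈ V1 ↔ x = 1 ∨ x = a := by
  constructor
  · intro hx
    induction hx using Subgroup.closure_induction with
    | mem x hx => exact Or.inr hx
    | one => exact Or.inl rfl
    | mul x y _ _ hx hy => rcases hx with rfl | rfl <;> rcases hy with rfl | rfl <;> decide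
    | inv x _ hx => rcases hx with rfl | rfl <;> decide
  · rintro (rfl | rfl)
    exacts [V1.one_mem, Subgroup.subset_closure rfl]

theorem mem_V4 {x : S3} : x ∈ V4 ↔ x = 1 ∨ x = b ∨ x = b * b := by
  constructor
  · intro hx
    induction hx using Subgroup.closure_induction with
    | mem x hx => exact Or.inr (Or.inl hx)
    | one => exact Or.inl rfl
    | mul x y _ _ hx hy =>
      rcases hx with rfl | rfl | rfl <;> rcases hy with rfl | rfl | rfl <;> decide
    | inv x _ hx => rcases hx with rfl | rfl | rfl <;> decide
  · have hb : b ∈ V4 := Subgroup.subset_closure rfl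
    rintro (rfl | rfl | rfl)
    exacts [V4.one_mem, hb, V4.mul_mem hb hb]

theorem el_mem_V1 {i : ℕ} (hi : i < 6) : el i ∈ V1 ↔ Nat.testBit 9 i = true := by
  have h : ∀ i < 6, (el i = 1 ∨ el i = a) ↔ Nat.testBit 9 i = true := by decide
  exact mem_V1.trans (h i hi)

theorem el_mem_V4 {i : ℕ} (hi : i < 6) : el i ∈ V4 ↔ Nat.testBit 7 i = true := by
  have h : ∀ i < 6, (el i = 1 ∨ el i = b ∨ el i = b * b) ↔ Nat.testBit 7 i = true := by decide
  exact mem_V4.trans (h i hi)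

theorem el_mem_V5 {i : ℕ} (hi : i < 6) : el i ∈ V5 ↔ Nat.testBit 63 i = true := by
  have h : ∀ i < 6, Nat.testBit 63 i = true := by decide
  exact iff_of_true (Subgroup.mem_top _) (h i hi)

theorem represents_prod {V W : Subgroup S3} {v w m : ℕ}
    (hV : ∀ {i}, i < 6 → (el i ∈ V ↔ Nat.testBit v i = true))
    (hW : ∀ {i}, i < 6 → (el i ∈ W ↔ Nat.testBit w i = true))
    (h : m < 2 ^ 36 ∧ ∀ i < 6, ∀ j < 6, m.testBit (6 * i + j) = true ↔
      (Nat.testBit v i && Nat.testBit w j) = true) : Represents m (V.prod W) := by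
  refine ⟨h.1, fun i hi j hj => ?_⟩
  rw [h.2 i hi j hj, Bool.and_eq_true, Subgroup.mem_prod, hV hi, hW hj]

theorem represents_closure {gens : List ℕ} {s : Set (S3 × S3)} {m : ℕ}
    (hs : ∀ q ∈ s, ∃ x ∈ gens, elPair x = q)
    (hg : ∀ x ∈ gens, x < 36 ∧ elPair x ∈ Subgroup.closure s)
    (h1 : closureMask gens = m)
    (h2 : m < 2 ^ 36 ∧ m.testBit 0 = true ∧ (∀ x ∈ gens, m.testBit x = true) ∧
      ∀ k < 36, m.testBit k = true → ∀ l < 36, m.testBit l = true →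
        m.testBit (pairMul k l) = true) : Represents m (Subgroup.closure s) := by
  obtain ⟨hlt, h0, hgm, hmul⟩ := h2
  have key : ∀ q ∈ Subgroup.closure s, ∃ k < 36, elPair k = q ∧ m.testBit k = true := by
    have hm : ∀ p q : S3 × S3, (∃ k < 36, elPair k = p ∧ m.testBit k = true) →
        (∃ k < 36, elPair k = q ∧ m.testBit k = true) →
        ∃ k < 36, elPair k = p * q ∧ m.testBit k = true := by
      rintro _ _ ⟨k, hk, rfl, hk'⟩ ⟨l, hl, rfl, hl'⟩
      exact ⟨_, pairMul_lt k l, elPair_pairMul hk hl, hmul k hk hk' l hl hl'⟩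
    intro q hq
    induction hq using Subgroup.closure_induction with
    | mem q hq =>
      obtain ⟨x, hx, rfl⟩ := hs q hq
      exact ⟨x, (hg x hx).1, rfl, hgm x hx⟩
    | one => exact ⟨0, by norm_num, rfl, h0⟩
    | mul p q _ _ hp hq => exact hm p q hp hq
    | inv p _ hp =>
      have h6 : ∀ x : S3, x⁻¹ = x * (x * (x * (x * x))) := by decide +kernel
      rw [show p⁻¹ = p * (p * (p * (p * p))) from Prod.ext (h6 p.1) (h6 p.2)]
      exact hm _ _ hp (hm _ _ hp (hm _ _ hp (hm _ _ hp hp)))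
  refine ⟨hlt, fun i hi j hj => ⟨fun h => ?_, fun h => ?_⟩⟩
  · rw [← elPair_eq i j hj]
    exact elPair_mem_of_testBit_closureMask hg (by rwa [h1])
  · obtain ⟨k, hk, he, hb⟩ := key _ h
    rw [elPair, Prod.mk.injEq] at he
    rw [← el_injective (by omega) hi he.1, ← el_injective (by omega) hj he.2, Nat.div_add_mod]
    exact hb

theorem represents_rep {i : ℕ} (hi : i < 22) : Represents (repMask i) (rep i) := by
  interval_cases i
  · exact represents_prod el_mem_V0 el_mem_V0 (by decide +kernel)
  · exact represents_prod el_mem_V1 el_mem_V0 (by decide +kernel)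
  · exact represents_prod el_mem_V0 el_mem_V1 (by decide +kernel)
  · refine represents_closure (gens := repGen 3) ?_ ?_ (by decide +kernel) (by decide +kernel)
    · rintro q rfl
      exact ⟨21, by decide, by decide⟩
    · intro x hx
      replace hx : x ∈ [21] := hx
      simp only [List.mem_cons, List.not_mem_nil, or_false] at hx
      subst hx
      exact ⟨by norm_num, Subgroup.subset_closure (by decide)⟩
  · exact represents_prod el_mem_V4 el_mem_V0 (by decide +kernel)
  · exact represents_prod el_mem_V0 el_mem_V4 (by decide +kernel)
  · refine represents_closure (gens := repGen 6) ?_ ?_ (by decide +kernel) (by decide +kernel)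
    · rintro q rfl
      exact ⟨7, by decide, by decide⟩
    · intro x hx
      replace hx : x ∈ [7] := hx
      simp only [List.mem_cons, List.not_mem_nil, or_false] at hx
      subst hx
      exact ⟨by norm_num, Subgroup.subset_closure (by decide)⟩
  · exact represents_prod el_mem_V1 el_mem_V1 (by decide +kernel)
  · exact represents_prod el_mem_V5 el_mem_V0 (by decide +kernel)
  · exact represents_prod el_mem_V0 el_mem_V5 (by decide +kernel)
  · refine represents_closure (gens := repGen 10) ?_ ?_ (by decide +kernel) (by decide +kernel)
    · rintro q (rfl | rfl)
      exacts [⟨21, by decide, by decide⟩, ⟨1, by decide, by decide⟩]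
    · intro x hx
      replace hx : x ∈ [21, 1] := hx
      simp only [List.mem_cons, List.not_mem_nil, or_false] at hx
      rcases hx with rfl | rfl <;>
        exact ⟨by norm_num, Subgroup.subset_closure (by decide)⟩
  · exact represents_prod el_mem_V4 el_mem_V1 (by decide +kernel)
  · exact represents_prod el_mem_V1 el_mem_V4 (by decide +kernel)
  · refine represents_closure (gens := repGen 13) ?_ ?_ (by decide +kernel) (by decide +kernel)
    · rintro q (rfl | rfl)
      exacts [⟨21, by decide, by decide⟩, ⟨6, by decide, by decide⟩]
    · intro x hx
      replace hx : x ∈ [21, 6] := hx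
      simp only [List.mem_cons, List.not_mem_nil, or_false] at hx
      rcases hx with rfl | rfl <;>
        exact ⟨by norm_num, Subgroup.subset_closure (by decide)⟩
  · refine represents_closure (gens := repGen 14) ?_ ?_ (by decide +kernel) (by decide +kernel)
    · rintro q (rfl | rfl)
      exacts [⟨21, by decide, by decide⟩, ⟨7, by decide, by decide⟩]
    · intro x hx
      replace hx : x ∈ [21, 7] := hx
      simp only [List.mem_cons, List.not_mem_nil, or_false] at hx
      rcases hx with rfl | rfl <;>
        exact ⟨by norm_num, Subgroup.subset_closure (by decide)⟩
  · exact represents_prod el_mem_V4 el_mem_V4 (by decide +kernel)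
  · exact represents_prod el_mem_V1 el_mem_V5 (by decide +kernel)
  · exact represents_prod el_mem_V5 el_mem_V1 (by decide +kernel)
  · exact represents_prod el_mem_V4 el_mem_V5 (by decide +kernel)
  · exact represents_prod el_mem_V5 el_mem_V4 (by decide +kernel)
  · refine represents_closure (gens := repGen 20) ?_ ?_ (by decide +kernel) (by decide +kernel)
    · rintro q (rfl | rfl | rfl)
      exacts [⟨21, by decide, by decide⟩, ⟨6, by decide, by decide⟩, ⟨1, by decide, by decide⟩]
    · intro x hx
      replace hx : x ∈ [21, 6, 1] := hx
      simp only [List.mem_cons, List.not_mem_nil, or_false] at hx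
      rcases hx with rfl | rfl | rfl <;>
        exact ⟨by norm_num, Subgroup.subset_closure (by decide)⟩
  · exact represents_prod el_mem_V5 el_mem_V5 (by decide +kernel)

theorem card_rep {i : ℕ} (hi : i < 22) : Nat.card (rep i) = repCard i := by
  have hr := represents_rep hi
  have hb : Function.Bijective fun k : Fin 36 => elPair k := by
    rw [Fintype.bijective_iff_surjective_and_card]
    refine ⟨fun q => ?_, by decide⟩
    obtain ⟨k, hk, h⟩ := exists_elPair q
    exact ⟨⟨k, hk⟩, h⟩
  have e : rep i ≃ {k : Fin 36 // (repMask i).testBit k = true} :=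
    ((Equiv.ofBijective _ hb).subtypeEquiv fun k => hr.testBit_iff k.2).symm
  have h : ∀ i < 22, Fintype.card {k : Fin 36 // (repMask i).testBit k = true} = repCard i := by
    decide +kernel
  rw [Nat.card_congr e, Nat.card_eq_fintype_card, h i hi]

theorem all_range {n : ℕ} {p : ℕ → Bool} (h : (List.range n).all p = true) {i : ℕ} (hi : i < n) :
    p i = true :=
  List.all_eq_true.1 h i (List.mem_range.2 hi)

theorem maskType_conjMask {i h g : ℕ} (hi : i < 22) (hh : h < 6) (hg : g < 6) :
    maskType (conjMask h (repMask i) g) = i :=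
  Nat.eq_of_beq_eq_true (all_range (all_range (all_range typeCheck_all hi) hh) hg)

/-- A subgroup properly containing `rep i` contains a conjugate of a larger representative. -/
theorem exists_twist_rep_le {i : ℕ} (hi : i < 22) {S : Subgroup (S3 × S3)} (hS : rep i ≤ S)
    (hne : S ≠ rep i) : ∃ t < 22, repCard i < repCard t ∧ ∃ h g, twist h (rep t) g ≤ S := by
  obtain ⟨q, hq, hqi⟩ := SetLike.exists_of_lt (lt_of_le_of_ne hS hne.symm)
  obtain ⟨s, hs, rfl⟩ := exists_elPair q
  have hc := all_range (all_range closureCheck_all hi) hs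
  rw [closureCheck, force_eq, Bool.or_eq_true, (represents_rep hi).testBit_iff hs] at hc
  simp only [hqi, false_or, Bool.and_eq_true] at hc
  obtain ⟨⟨⟨⟨h1, h2⟩, h3⟩, h4⟩, h5⟩ := hc
  generalize typeLookup subgroupTable (closureMask (s :: repGen i)) = w at h1 h2 h3 h4 h5
  have h1 := Nat.eq_of_beq_eq_true h1
  simp only [Nat.blt_eq] at h2 h3 h4 h5
  have hr := (represents_rep h2).twist h3 h4
  rw [h1] at hr
  refine ⟨w.1, h2, h5, el w.2.1, el w.2.2, fun p hp => ?_⟩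
  obtain ⟨k, hk, rfl⟩ := exists_elPair p
  refine elPair_mem_of_testBit_closureMask (fun x hx => ?_) ((hr.testBit_iff hk).2 hp)
  have hgen : ∀ i < 22, ∀ x ∈ repGen i, x < 36 ∧ (repMask i).testBit x = true := by
    decide +kernel
  rcases List.mem_cons.1 hx with rfl | hx
  · exact ⟨hs, hq⟩
  · obtain ⟨hx36, hb⟩ := hgen i hi x hx
    exact ⟨hx36, hS (((represents_rep hi).testBit_iff hx36).1 hb)⟩

theorem twist_mono {h g : S3} {S T : Subgroup (S3 × S3)} (hST : S ≤ T) :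
    twist h S g ≤ twist h T g := fun _ hq => hST hq

/-- Every subgroup of `S₃ × S₃` is conjugate to one of the representatives. -/
theorem exists_eq_twist_rep (S : Subgroup (S3 × S3)) : ∃ i < 22, ∃ h g, S = twist h (rep i) g := by
  have key : ∀ n i, i < 22 → ∀ h g, twist h (rep i) g ≤ S → 36 ≤ repCard i + n →
      ∃ i < 22, ∃ h g, S = twist h (rep i) g := by
    have hmax : ∀ i < 22, repCard i ≤ 36 := by decide
    intro n
    induction n with
    | zero =>
      intro i hi h g hle hn
      by_contra hne
      have hle' := twist_mono (h := h⁻¹) (g := g⁻¹) hle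
      rw [twist_twist, mul_inv_cancel, inv_mul_cancel, twist_one] at hle'
      obtain ⟨t, ht, hlt, -⟩ := exists_twist_rep_le hi hle' fun he => hne ⟨i, hi, h, g, by
        rw [← he, twist_twist]; simp⟩
      have := hmax t ht
      omega
    | succ n ih =>
      intro i hi h g hle hn
      by_contra hne
      have hle' := twist_mono (h := h⁻¹) (g := g⁻¹) hle
      rw [twist_twist, mul_inv_cancel, inv_mul_cancel, twist_one] at hle'
      obtain ⟨t, ht, hlt, h', g', hle2⟩ :=
        exists_twist_rep_le hi hle' fun he => hne ⟨i, hi, h, g, by rw [← he, twist_twist]; simp⟩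
      have hle3 := twist_mono (h := h) (g := g) hle2
      rw [twist_twist, twist_twist, inv_mul_cancel, mul_inv_cancel, twist_one] at hle3
      exact hne (ih t ht _ _ hle3 (by omega))
  have h0 : rep 0 ≤ S := by
    rintro ⟨x, y⟩ ⟨hx, hy⟩
    obtain rfl : x = 1 := hx
    obtain rfl : y = 1 := hy
    exact S.one_mem
  exact key 36 0 (by norm_num) 1 1 (by rwa [twist_one]) (by omega)

/-- The number of the conjugacy class of a subgroup. -/
noncomputable def typeOf (S : Subgroup (S3 × S3)) : ℕ := (exists_eq_twist_rep S).choose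

theorem typeOf_lt (S : Subgroup (S3 × S3)) : typeOf S < 22 :=
  (exists_eq_twist_rep S).choose_spec.1

theorem typeOf_eq_maskType {m : ℕ} {S : Subgroup (S3 × S3)} (hm : Represents m S) :
    typeOf S = maskType m := by
  obtain ⟨h, g, he⟩ := (exists_eq_twist_rep S).choose_spec.2
  change S = twist h (rep (typeOf S)) g at he
  obtain ⟨i, hi, rfl⟩ := exists_el h
  obtain ⟨j, hj, rfl⟩ := exists_el g
  have hr := (represents_rep (typeOf_lt S)).twist hi hj
  rw [← he] at hr
  rw [hm.mask_eq hr, maskType_conjMask (typeOf_lt S) hi hj]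

theorem typeOf_twist_rep {i : ℕ} (hi : i < 22) (h g : S3) : typeOf (twist h (rep i) g) = i := by
  obtain ⟨k, hk, rfl⟩ := exists_el h
  obtain ⟨l, hl, rfl⟩ := exists_el g
  rw [typeOf_eq_maskType ((represents_rep hi).twist hk hl), maskType_conjMask hi hk hl]

theorem typeOf_rep {i : ℕ} (hi : i < 22) : typeOf (rep i) = i := by
  simpa using typeOf_twist_rep hi 1 1

theorem typeOf_twist (h : S3) (S : Subgroup (S3 × S3)) (g : S3) :
    typeOf (twist h S g) = typeOf S := by
  obtain ⟨i, hi, k, l, rfl⟩ := exists_eq_twist_rep S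
  rw [twist_twist, typeOf_twist_rep hi, typeOf_twist_rep hi]

/-- The class of `(S₃ × S₃) / rep i`. -/
noncomputable def repCls (R : Type) [CommRing R] (i : ℕ) : B R S3 := cls R (ofSubgroup (rep i))

/-- The classes of the representatives span the double Burnside algebra. -/
theorem span_repCls (R : Type) [CommRing R] :
    Submodule.span R (Set.range fun i : Fin 22 => repCls R i) = ⊤ := by
  rw [eq_top_iff, ← span_cls_ofSubgroup R, Submodule.span_le]
  rintro _ ⟨U, rfl⟩
  obtain ⟨i, hi, h, g, rfl⟩ := exists_eq_twist_rep U
  obtain ⟨f⟩ := ofSubgroup_twist_iso h (rep i) g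
  refine Submodule.subset_span ⟨⟨i, hi⟩, ?_⟩
  exact (cls_iso R f).symm

/-! ## The algebra `A` in coordinates -/

section Coordinates

variable {S : Type}

/-- The element of `A` with the given coordinates. -/
def ofCoord [Zero S] (f : ℕ → S) : A S where
  s := Matrix.of fun i j => f (3 * i + j)
  t i := f (9 + i)
  u := f 12
  v := f 13
  w := f 14
  x i := f (15 + i)
  y := f 18
  z := eps (f 19) (f 20) (f 21)

/-- The coordinates of an element of `A`. -/
def coord [Zero S] (m : A S) : ℕ → S
  | 0 => m.s 0 0 | 1 => m.s 0 1 | 2 => m.s 0 2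
  | 3 => m.s 1 0 | 4 => m.s 1 1 | 5 => m.s 1 2
  | 6 => m.s 2 0 | 7 => m.s 2 1 | 8 => m.s 2 2
  | 9 => m.t 0 | 10 => m.t 1 | 11 => m.t 2
  | 12 => m.u | 13 => m.v | 14 => m.w
  | 15 => m.x 0 | 16 => m.x 1 | 17 => m.x 2
  | 18 => m.y | 19 => m.z.fst | 20 => m.z.snd.1 | 21 => m.z.snd.2
  | _ => 0

theorem ofCoord_coord [Zero S] (m : A S) : ofCoord (coord m) = m := by
  apply A.ext'
  · ext i j; fin_cases i <;> fin_cases j <;> rfl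
  · ext i; fin_cases i <;> rfl
  · rfl
  · rfl
  · rfl
  · ext i; fin_cases i <;> rfl
  all_goals rfl

theorem coord_ofCoord [Zero S] (f : ℕ → S) {k : ℕ} (hk : k < 22) : coord (ofCoord f) k = f k := by
  interval_cases k <;> rfl

theorem ofCoord_congr [Zero S] {f f' : ℕ → S} (h : ∀ k < 22, f k = f' k) :
    ofCoord f = ofCoord f' := by
  apply A.ext'
  · ext i j; exact h _ (by omega)
  · ext i; exact h _ (by omega)
  · exact h _ (by norm_num)
  · exact h _ (by norm_num)
  · exact h _ (by norm_num)
  · ext i; exact h _ (by omega)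
  all_goals exact h _ (by norm_num)

theorem coord_injective [Zero S] {m n : A S} (h : ∀ k < 22, coord m k = coord n k) : m = n := by
  rw [← ofCoord_coord m, ← ofCoord_coord n, ofCoord_congr h]

variable [CommRing S]

theorem ofCoord_add (f f' : ℕ → S) : ofCoord (fun k => f k + f' k) = ofCoord f + ofCoord f' := rfl

theorem ofCoord_zero : ofCoord (fun _ => (0 : S)) = 0 := rfl

theorem ofCoord_smul {K : Type} [CommRing K] [Algebra K S] (c : K) (f : ℕ → S) :
    ofCoord (fun k => c • f k) = c • ofCoord f := rfl

theorem ofCoord_sum {ι : Type*} (s : Finset ι) (f : ι → ℕ → S) :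
    ofCoord (fun k => ∑ i ∈ s, f i k) = ∑ i ∈ s, ofCoord (f i) := by
  classical
  induction s using Finset.induction_on with
  | empty => simpa using ofCoord_zero
  | insert i s hi ih =>
    rw [Finset.sum_insert hi, ← ih, ← ofCoord_add]
    congr 1
    ext k
    rw [Finset.sum_insert hi]

/-- The elements of the standard basis of `A`. -/
def unitVec (i : ℕ) : A S := ofCoord fun k => if k = i then 1 else 0

theorem ofCoord_eq_sum (f : ℕ → S) :
    ofCoord f = ∑ i ∈ Finset.range 22, f i • (unitVec i : A S) := by
  have h : ∀ i ∈ Finset.range 22, f i • (unitVec i : A S) =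
      ofCoord fun k => f i • if k = i then 1 else 0 := fun i _ => rfl
  rw [Finset.sum_congr rfl h, ← ofCoord_sum]
  refine ofCoord_congr fun k hk => ?_
  simp [hk]

theorem ofCoord_mul (p q : ℕ → ℤ) :
    (ofCoord (fun k => (p k : ℚ)) * ofCoord (fun k => (q k : ℚ)) : A ℚ) =
      ofCoord fun k => ((mulCoord p q).getD k 0 : ℚ) := by
  refine coord_injective fun k hk => ?_
  rw [coord_ofCoord _ hk]
  interval_cases k <;>
    simp [coord, ofCoord, mulCoord, Matrix.mul_apply, Matrix.mulVec, Matrix.vecMul, dotProduct,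
      Fin.sum_univ_three] <;> ring

end Coordinates

/-- The image of `repCls i` in `A`. -/
def image (i : ℕ) : A ℚ := ofCoord fun k => (imageRow i k : ℚ)

theorem mackeyTerms_eq (m n : ℕ) (l : List ℕ) (cont : List (ℕ × ℕ) → Bool) :
    mackeyTerms m n l cont = cont (l.map (mackeyTerm m n)) := by
  induction l generalizing cont with
  | nil => rfl
  | cons g l ih => rw [mackeyTerms, force_eq, force_eq, force_eq, ih]; rfl

theorem image_mul {i j : ℕ} (hi : i < 22) (hj : j < 22) :
    ((repCard i * repCard j : ℕ) : ℚ) • (image i * image j) = ∑ g ∈ Finset.range 6,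
      ((mackeyTerm (repMask i) (repMask j) g).2 : ℚ) •
        image (mackeyTerm (repMask i) (repMask j) g).1 := by
  have hc := all_range (all_range mulCheck_all hi) hj
  rw [mulCheck, force_eq, mackeyTerms_eq] at hc
  rw [image, image, ofCoord_mul]
  simp only [image, ← ofCoord_smul, ← ofCoord_sum]
  refine ofCoord_congr fun k hk => ?_
  have h := of_decide_eq_true (all_range hc hk)
  simp only [smul_eq_mul]
  have h' := congrArg (Int.cast : ℤ → ℚ) h
  rw [Int.cast_mul, Int.cast_natCast] at h'
  rw [← h', termSum, List.map_map, Finset.sum_range, Fin.sum_univ_six]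
  simp [List.range_succ, add_assoc]

/-- A conjugation invariant function of subgroups, which gives rise to the isomorphism. -/
noncomputable def weight (S : Subgroup (S3 × S3)) : A ℚ :=
  ((repCard (typeOf S) : ℚ) / 36) • image (typeOf S)

theorem weight_twist (h : S3) (S : Subgroup (S3 × S3)) (g : S3) :
    weight (twist h S g) = weight S := by
  rw [weight, weight, typeOf_twist]

theorem card_S3 : Nat.card S3 = 6 := by
  rw [Nat.card_eq_fintype_card, Fintype.card_perm]; rfl

theorem repCard_ne_zero {i : ℕ} (hi : i < 22) : (repCard i : ℚ) ≠ 0 := by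
  have h : ∀ i < 22, repCard i ≠ 0 := by decide
  exact_mod_cast h i hi

/-- The linear map `B_ℚ(S₃,S₃) → A` underlying the isomorphism. -/
noncomputable def ghostMap : B ℚ S3 →ₗ[ℚ] A ℚ := ghost ℚ weight

theorem ghostMap_repCls {i : ℕ} (hi : i < 22) : ghostMap (repCls ℚ i) = image i := by
  have h := card_smul_stabSum_ofSubgroup weight_twist (rep i)
  rw [card_rep hi, card_S3, weight, typeOf_rep hi, ← Nat.cast_smul_eq_nsmul ℚ,
    ← Nat.cast_smul_eq_nsmul ℚ, smul_smul] at h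
  rw [ghostMap, repCls, ghost_cls]
  apply smul_right_injective _ (repCard_ne_zero hi)
  change (repCard i : ℚ) • _ = (repCard i : ℚ) • _
  rw [h]
  congr 1
  push_cast
  ring

theorem ghostMap_repCls_mul {i j : ℕ} (hi : i < 22) (hj : j < 22) :
    ghostMap (repCls ℚ i * repCls ℚ j) = image i * image j := by
  have h := card_smul_stabSum_tensor_ofSubgroup weight_twist (rep i) (rep j)
  rw [card_rep hi, card_rep hj, card_S3] at h
  have hs : ∑ g : S3, link (twist 1 (rep i) g) (rep j) • weight (star (twist 1 (rep i) g) (rep j))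
      = (1 / 36 : ℚ) • ∑ g ∈ Finset.range 6, ((mackeyTerm (repMask i) (repMask j) g).2 : ℚ) •
        image (mackeyTerm (repMask i) (repMask j) g).1 := by
    rw [← Equiv.sum_comp (Equiv.ofBijective _ el_bijOn), Finset.sum_range, Finset.smul_sum]
    refine Finset.sum_congr rfl fun g _ => ?_
    have hr := (represents_rep hi).twist_right g.2
    rw [Equiv.ofBijective_apply, hr.link (represents_rep hj), weight,
      typeOf_eq_maskType (hr.star (represents_rep hj)), mackeyTerm]
    simp only [← Nat.cast_smul_eq_nsmul ℚ, smul_smul]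
    congr 1
    push_cast
    ring
  rw [hs, ← image_mul hi hj] at h
  rw [ghostMap, repCls, repCls, cls_mul, ghost_cls]
  have hne : ((repCard i * repCard j * 6 : ℕ) : ℚ) ≠ 0 := by
    push_cast
    exact mul_ne_zero (mul_ne_zero (repCard_ne_zero hi) (repCard_ne_zero hj)) (by norm_num)
  apply smul_right_injective _ hne
  change ((repCard i * repCard j * 6 : ℕ) : ℚ) • _ = ((repCard i * repCard j * 6 : ℕ) : ℚ) • _
  rw [Nat.cast_smul_eq_nsmul, h]
  simp only [← Nat.cast_smul_eq_nsmul ℚ, smul_smul]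
  congr 1
  push_cast
  ring

theorem ghostMap_mul (x y : B ℚ S3) : ghostMap (x * y) = ghostMap x * ghostMap y := by
  have hx : x ∈ Submodule.span ℚ (Set.range fun i : Fin 22 => repCls ℚ i) := by
    rw [span_repCls]; trivial
  have hy : y ∈ Submodule.span ℚ (Set.range fun i : Fin 22 => repCls ℚ i) := by
    rw [span_repCls]; trivial
  induction hx using Submodule.span_induction with
  | mem x hx =>
    obtain ⟨i, rfl⟩ := hx
    induction hy using Submodule.span_induction with
    | mem y hy =>
      obtain ⟨j, rfl⟩ := hy
      rw [ghostMap_repCls_mul i.2 j.2, ghostMap_repCls i.2, ghostMap_repCls j.2]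
    | zero => simp
    | add y z _ _ hy hz => rw [mul_add, map_add, hy, hz, map_add, mul_add]
    | smul r y _ hy => rw [mul_smul_comm, map_smul, hy, map_smul, mul_smul_comm]
  | zero => simp
  | add x z _ _ hx hz => rw [add_mul, map_add, hx, hz, map_add, add_mul]
  | smul r x _ hx => rw [smul_mul_assoc, map_smul, hx, map_smul, smul_mul_assoc]

/-! ## The map `γ` -/

/-- The images under `γ` of the standard basis of `A`. -/
noncomputable def gammaBasis : ℕ → B ℚ S3
  | 0 => e
  | 1 => b_eg
  | 2 => b_eh
  | 3 => b_ge
  | 4 => g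
  | 5 => b_gh
  | 6 => b_he
  | 7 => b_hg
  | 8 => h
  | 9 => b_e4
  | 10 => b_g4
  | 11 => b_h4
  | 12 => ε₂
  | 13 => b_24
  | 14 => ε₃
  | 15 => b_4e
  | 16 => b_4g
  | 17 => b_4h
  | 18 => b_42
  | 19 => ε₄
  | 20 => bEta
  | 21 => bXi
  | _ => 0

/-- The coefficients of `24 • gammaBasis i`. -/
def gammaRows : List (List ℤ) := [
    [-12, 24, 0, 0, 12, 0, 0, 0, 0, 0, 0, 0, 0, 0, 0, 0, 0, 0, 0, 0, 0, 0],
    [12, -24, -12, 0, -12, 0, 0, 24, 0, 0, 0, 12, 0, 0, 0, 0, 0, 0, 0, 0, 0, 0],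
    [-3, 6, 12, 0, 3, -9, 0, -24, 0, 0, 0, -12, 18, 0, 0, 9, 0, 0, 0, 0, 0, 0],
    [-32, 48, 0, 0, 24, 0, 0, 0, 0, 0, 0, 0, 0, 0, 0, 0, 0, 0, 0, 0, 0, 0],
    [32, -48, -32, 0, -24, 0, 0, 48, 0, 0, 0, 24, 0, 0, 0, 0, 0, 0, 0, 0, 0, 0],
    [-8, 12, 32, 0, 6, -24, 0, -48, 0, 0, 0, -24, 36, 0, 0, 18, 0, 0, 0, 0, 0, 0],
    [-8, 0, 0, 0, 24, 0, 0, 0, 0, 0, 0, 0, 0, 0, 0, 0, 0, 0, 0, 0, 0, 0],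
    [8, 0, -8, 0, -24, 0, 0, 0, 0, 0, 0, 24, 0, 0, 0, 0, 0, 0, 0, 0, 0, 0],
    [-2, 0, 8, 0, 6, -6, 0, 0, 0, 0, 0, -24, 0, 0, 0, 18, 0, 0, 0, 0, 0, 0],
    [-3, 6, 6, 0, 3, 3, 0, -12, 0, -6, 0, -6, -6, 0, 0, -3, 12, 0, 6, 0, 0, 0],
    [-8, 12, 16, 0, 6, 8, 0, -24, 0, -16, 0, -12, -12, 0, 0, -6, 24, 0, 12, 0, 0, 0],
    [-2, 0, 4, 0, 6, 2, 0, 0, 0, -4, 0, -12, 0, 0, 0, -6, 0, 0, 12, 0, 0, 0],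
    [-24, 24, 24, 24, 0, 0, 0, -48, 0, 0, 0, 0, 0, 0, 0, 0, 0, 0, 0, 0, 0, 0],
    [-12, 12, 12, 12, 0, 12, 0, -24, 0, -12, -12, 0, -12, 0, 0, 0, 24, 0, 0, 0, 0, 0],
    [-6, 0, 0, 0, 6, 6, 12, 0, 0, 0, 0, 0, 0, 0, 0, -18, 0, 0, 0, 0, 0, 0],
    [4, -8, 0, 0, -4, 0, 0, 0, 8, 0, 0, 0, 0, 0, 0, 0, 0, 0, 0, 0, 0, 0],
    [-4, 8, 4, 0, 4, 0, 0, -8, -8, 0, 0, -4, 0, 0, 0, 0, 0, 8, 0, 0, 0, 0],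
    [1, -2, -4, 0, -1, 3, 0, 8, 2, 0, 0, 4, -6, 0, 0, -3, 0, -8, 0, 6, 0, 0],
    [-12, 12, 12, 12, 12, 0, 0, -24, -12, 0, 0, -12, 0, -12, 0, 0, 0, 24, 0, 0, 0, 0],
    [12, 0, 0, -24, 0, 0, -12, 0, 0, 0, 0, 0, 0, 0, 24, 0, 0, 0, 0, 0, 0, 0],
    [1, -2, -2, 0, -1, -1, 0, 4, 2, 2, 0, 2, 2, 0, 0, 1, -4, -4, -2, -2, 0, 4],
    [6, -18, -18, 6, -6, -6, 0, 36, 18, 18, -6, 18, 18, -6, 0, 6, -36, -36, -18, -18, 6, 36]]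

def gammaRow (i l : ℕ) : ℤ := (gammaRows.getD i []).getD l 0

/-- The coordinates of `x₁ * x₂ * x₃`. -/
def conjRow (k : ℕ) : ℤ :=
  [0, -2, 0, 6, -22, -4, 0, 7, 1, 0, -4, 1, 1, 0, 1, 0, 0, 6, 0, 1, 0, 0].getD k 0

/-- The coordinates of `6 • (x₁ * x₂ * x₃)⁻¹`. -/
def conjInvRow (k : ℕ) : ℤ :=
  [3, 1, 4, -3, 0, 0, 21, 0, 6, 0, 0, -6, 6, 0, 6, -126, 0, -36, 0, 6, 36, 0].getD k 0

/-- Six times the conjugate of a unit vector by `x₁ * x₂ * x₃`, in coordinates. -/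
def conjList (i : ℕ) : List ℤ :=
  mulCoord (fun k => (mulCoord conjInvRow fun k => if k = i then 1 else 0).getD k 0) conjRow

/-- The two sides of the formula for the image of `gammaBasis i` agree. -/
def gammaCheck (i : ℕ) : Bool := (List.range 22).all fun k =>
  decide (4 * (conjList i).getD k 0 =
    ((List.range 22).map fun l => gammaRow i l * imageRow l k).sum)

set_option maxRecDepth 100000 in
theorem gammaCheck_all : ((List.range 22).all gammaCheck) = true := by decide +kernel

theorem sum_map_range (n : ℕ) (f : ℕ → ℤ) :
    ((List.range n).map f).sum = ∑ l ∈ Finset.range n, f l := rfl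

/-- The unit `x₁ * x₂ * x₃` of `A`. -/
def conjUnit : (A ℚ)ˣ := x₁ * x₂ * x₃

theorem coe_conjUnit : (conjUnit : A ℚ) = ofCoord fun k => (conjRow k : ℚ) := by
  refine coord_injective fun k hk => ?_
  rw [coord_ofCoord _ hk]
  change coord (x₁.val * x₂.val * x₃.val) k = _
  interval_cases k <;>
    simp [x₁, x₂, x₃, coord, conjRow, Matrix.mul_apply, dotProduct, Fin.sum_univ_three] <;>
    norm_num

theorem coe_conjUnit_inv :
    (6 : ℚ) • (↑conjUnit⁻¹ : A ℚ) = ofCoord fun k => (conjInvRow k : ℚ) := by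
  refine coord_injective fun k hk => ?_
  rw [coord_ofCoord _ hk]
  change coord ((6 : ℚ) • (x₃.inv * (x₂.inv * x₁.inv))) k = _
  interval_cases k <;>
    (simp [x₁, x₂, x₃, coord, conjInvRow, dotProduct]; try norm_num)

/-- The combination of `repCls n, repCls (n + 1), …` with the given coefficients. -/
noncomputable def combination : List ℤ → ℕ → B ℚ S3
  | [], _ => 0
  | c :: l, n => (c : ℚ) • repCls ℚ n + combination l (n + 1)

theorem combination_eq_sum (l : List ℤ) (n : ℕ) :
    combination l n = ∑ k ∈ Finset.range l.length, (l.getD k 0 : ℚ) • repCls ℚ (n + k) := by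
  induction l generalizing n with
  | nil => rfl
  | cons c l ih =>
    rw [combination, ih, List.length_cons, Finset.sum_range_succ', add_comm]
    congr 1
    refine Finset.sum_congr rfl fun k _ => ?_
    rw [List.getD_cons_succ, add_right_comm, add_assoc]

set_option maxHeartbeats 2000000 in
theorem smul_gammaBasis_eq_combination {i : ℕ} (hi : i < 22) :
    (24 : ℚ) • gammaBasis i = combination (gammaRows.getD i []) 0 := by
  have h0 : H00 = repCls ℚ 0 := rfl
  have h1 : H10 = repCls ℚ 1 := rfl
  have h2 : H01 = repCls ℚ 2 := rfl
  have h3 : HD1 = repCls ℚ 3 := rfl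
  have h4 : H40 = repCls ℚ 4 := rfl
  have h5 : H04 = repCls ℚ 5 := rfl
  have h6 : HD4 = repCls ℚ 6 := rfl
  have h7 : H11 = repCls ℚ 7 := rfl
  have h8 : H50 = repCls ℚ 8 := rfl
  have h9 : H05 = repCls ℚ 9 := rfl
  have h10 : H6 = repCls ℚ 10 := rfl
  have h11 : H41 = repCls ℚ 11 := rfl
  have h12 : H14 = repCls ℚ 12 := rfl
  have h13 : H7 = repCls ℚ 13 := rfl
  have h14 : HD5 = repCls ℚ 14 := rfl
  have h15 : H44 = repCls ℚ 15 := rfl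
  have h16 : H15 = repCls ℚ 16 := rfl
  have h17 : H51 = repCls ℚ 17 := rfl
  have h18 : H45 = repCls ℚ 18 := rfl
  have h19 : H54 = repCls ℚ 19 := rfl
  have h20 : H8 = repCls ℚ 20 := rfl
  have h21 : H55 = repCls ℚ 21 := rfl
  simp only [gammaRows]
  interval_cases i <;>
    simp only [List.getD_cons_zero, List.getD_cons_succ, combination, Int.cast_zero, zero_smul,
      zero_add, gammaBasis] <;> norm_num only [zero_smul, zero_add, add_zero]
  · rw [e, h0, h1, h4]; module
  · rw [b_eg, h0, h1, h2, h4, h7, h11]; module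
  · rw [b_eh, h0, h1, h2, h4, h5, h7, h11, h12, h15]; module
  · rw [b_ge, h0, h1, h4]; module
  · rw [g, h0, h1, h2, h4, h7, h11]; module
  · rw [b_gh, h0, h1, h2, h4, h5, h7, h11, h12, h15]; module
  · rw [b_he, h0, h4]; module
  · rw [b_hg, h0, h2, h4, h11]; module
  · rw [h, h0, h2, h4, h5, h11, h15]; module
  · rw [b_e4, h0, h1, h2, h4, h5, h7, h9, h11, h12, h15, h16, h18]; module
  · rw [b_g4, h0, h1, h2, h4, h5, h7, h9, h11, h12, h15, h16, h18]; module
  · rw [b_h4, h0, h2, h4, h5, h9, h11, h15, h18]; module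
  · rw [ε₂, h0, h1, h2, h3, h7]; module
  · rw [b_24, h0, h1, h2, h3, h5, h7, h9, h10, h12, h16]; module
  · rw [ε₃, h0, h4, h5, h6, h15]; module
  · rw [b_4e, h0, h1, h4, h8]; module
  · rw [b_4g, h0, h1, h2, h4, h7, h8, h11, h17]; module
  · rw [b_4h, h0, h1, h2, h4, h5, h7, h8, h11, h12, h15, h17, h19]; module
  · rw [b_42, h0, h1, h2, h3, h4, h7, h8, h11, h13, h17]; module
  · rw [ε₄, h0, h3, h6, h14]; module
  · rw [bEta, h0, h1, h2, h4, h5, h7, h8, h9, h11, h12, h15, h16, h17, h18, h19, h21]; module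
  · rw [bXi, h0, h1, h2, h3, h4, h5, h7, h8, h9, h10, h11, h12, h13, h15, h16, h17,
      h18, h19, h20, h21]
    module

theorem smul_gammaBasis {i : ℕ} (hi : i < 22) :
    (24 : ℚ) • gammaBasis i = ∑ l ∈ Finset.range 22, (gammaRow i l : ℚ) • repCls ℚ l := by
  have hlen : ∀ i < 22, (gammaRows.getD i []).length = 22 := by decide
  rw [smul_gammaBasis_eq_combination hi, combination_eq_sum, hlen i hi]
  simp only [zero_add, gammaRow]

theorem gamma_eq_sum (m : A ℚ) :
    gamma m = ∑ i ∈ Finset.range 22, coord m i • gammaBasis i := by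
  simp only [Finset.sum_range_succ, Finset.sum_range_zero, coord, gammaBasis, gamma]
  abel

theorem ghostMap_gammaBasis {i : ℕ} (hi : i < 22) :
    ghostMap (gammaBasis i) = ↑conjUnit⁻¹ * (unitVec i : A ℚ) * ↑conjUnit := by
  have h24 : (24 : ℚ) ≠ 0 := by norm_num
  apply smul_right_injective _ h24
  change (24 : ℚ) • ghostMap (gammaBasis i) = (24 : ℚ) • _
  have hu : (unitVec i : A ℚ) = ofCoord fun k => ((if k = i then 1 else 0 : ℤ) : ℚ) := by
    simp [unitVec]
  have hr : (24 : ℚ) • (↑conjUnit⁻¹ * (unitVec i : A ℚ) * ↑conjUnit : A ℚ) =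
      (4 : ℚ) • ofCoord fun k => ((conjList i).getD k 0 : ℚ) := by
    rw [conjList, ← ofCoord_mul, ← ofCoord_mul conjInvRow, ← coe_conjUnit_inv, ← coe_conjUnit,
      ← hu, smul_mul_assoc, smul_mul_assoc, smul_smul]
    norm_num
  rw [hr, ← map_smul, smul_gammaBasis hi, map_sum]
  have hs : ∀ l ∈ Finset.range 22, ghostMap ((gammaRow i l : ℚ) • repCls ℚ l) =
      ofCoord fun k => (gammaRow i l : ℚ) • (imageRow l k : ℚ) := fun l hl => by
    rw [map_smul, ghostMap_repCls (Finset.mem_range.1 hl), image, ← ofCoord_smul]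
  rw [Finset.sum_congr rfl hs, ← ofCoord_sum, ← ofCoord_smul]
  refine ofCoord_congr fun k hk => ?_
  have h := of_decide_eq_true (all_range (all_range gammaCheck_all hi) hk)
  rw [sum_map_range] at h
  have h' := congrArg (Int.cast : ℤ → ℚ) h
  push_cast at h'
  simpa using h'.symm

theorem ghostMap_gamma (m : A ℚ) : ghostMap (gamma m) = ↑conjUnit⁻¹ * m * ↑conjUnit := by
  nth_rewrite 2 [← ofCoord_coord m]
  rw [gamma_eq_sum, map_sum, ofCoord_eq_sum, Finset.mul_sum, Finset.sum_mul]
  refine Finset.sum_congr rfl fun i hi => ?_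
  rw [map_smul, ghostMap_gammaBasis (Finset.mem_range.1 hi), mul_smul_comm, smul_mul_assoc]

/-! ## The lattice cut out by the congruences -/

section Lattice

variable {S : Type} [CommRing S]

/-- A parametrisation of the coordinates of the elements that satisfy the congruences. -/
def latticeCoord (p : ℕ → S) : ℕ → S
  | 9 => 2 * p 9 | 10 => 2 * p 10 | 11 => 2 * p 11 | 13 => 2 * p 13
  | 14 => p 19 + 2 * p 20 + 4 * p 14
  | 15 => 4 * p 15 | 16 => 4 * p 16 | 17 => 4 * p 17 | 18 => 2 * p 18
  | 20 => 4 * p 20 | 21 => 4 * p 21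
  | k => p k

theorem latticeCoord_sum {ι : Type*} (s : Finset ι) (c : ι → S) (f : ι → ℕ → S) {k : ℕ}
    (hk : k < 22) : latticeCoord (fun l => ∑ i ∈ s, c i * f i l) k =
      ∑ i ∈ s, c i * latticeCoord (f i) k := by
  interval_cases k <;>
    simp only [latticeCoord, Finset.mul_sum, ← Finset.sum_add_distrib] <;>
    exact Finset.sum_congr rfl fun i _ => by ring

theorem latticeCoord_map {T : Type} [CommRing T] (φ : S →+* T) (p : ℕ → S) {k : ℕ} (hk : k < 22) :
    φ (latticeCoord p k) = latticeCoord (fun l => φ (p l)) k := by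
  interval_cases k <;> simp [latticeCoord, map_ofNat]

theorem latticeCoord_congr {p q : ℕ → S} (h : ∀ k < 22, p k = q k) {k : ℕ} (hk : k < 22) :
    latticeCoord p k = latticeCoord q k := by
  have h19 := h 19 (by norm_num)
  have h20 := h 20 (by norm_num)
  have hk' := h k hk
  interval_cases k <;> simp only [latticeCoord, hk', h19, h20]

theorem eq_zero_of_latticeCoord_eq_zero {p : ℕ → ℚ} (h : ∀ k < 22, latticeCoord p k = 0) {k : ℕ}
    (hk : k < 22) : p k = 0 := by
  have h14 := h 14 (by norm_num)
  have h19 := h 19 (by norm_num)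
  have h20 := h 20 (by norm_num)
  have hk' := h k hk
  simp only [latticeCoord] at h14 h19 h20
  interval_cases k <;> simp only [latticeCoord] at hk' <;> linarith

end Lattice

/-- The parameters of `image i`. -/
def latticeRow (i : ℕ) : ℕ → ℤ
  | 9 => imageRow i 9 / 2 | 10 => imageRow i 10 / 2 | 11 => imageRow i 11 / 2
  | 13 => imageRow i 13 / 2
  | 14 => (2 * imageRow i 14 - 2 * imageRow i 19 - imageRow i 20) / 8
  | 15 => imageRow i 15 / 4 | 16 => imageRow i 16 / 4 | 17 => imageRow i 17 / 4
  | 18 => imageRow i 18 / 2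
  | 20 => imageRow i 20 / 4 | 21 => imageRow i 21 / 4
  | k => imageRow i k

/-- Three times the inverse of the matrix with entries `latticeRow i k`. -/
def inverseRows : List (List ℤ) := [
    [-12, 18, 12, 0, 9, -12, 0, -18, 0, 0, 0, -9, 18, 0, 0, 9, 0, 0, 0, 0, 0, 0],
    [12, -18, 0, 0, -9, 0, 0, 0, 0, 0, 0, 0, 0, 0, 0, 0, 0, 0, 0, 0, 0, 0],
    [-84, 126, 12, 0, 63, -24, 0, -18, 0, 12, 0, -9, 36, 0, 0, 18, -18, 0, -9, 0, 0, 0],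
    [42, -69, -42, 0, -24, 42, 0, 69, 0, 0, 0, 24, -69, 0, 0, -24, 0, 0, 0, 0, 0, 0],
    [-42, 69, 0, 0, 24, 0, 0, 0, 0, 0, 0, 0, 0, 0, 0, 0, 0, 0, 0, 0, 0, 0],
    [294, -483, -42, 0, -168, 84, 0, 69, 0, -42, 0, 24, -138, 0, 0, -48, 69, 0, 24, 0, 0, 0],
    [9, -15, -9, 0, -6, 9, 0, 15, 3, 0, 0, 6, -15, 0, 0, -6, 0, -3, 0, 3, 0, 0],
    [-9, 15, 0, 0, 6, 0, 0, 0, -3, 0, 0, 0, 0, 0, 0, 0, 0, 0, 0, 0, 0, 0],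
    [63, -105, -9, 0, -42, 18, 0, 15, 21, -9, 0, 6, -30, 0, 0, -12, 15, -3, 6, 6, 0, -3],
    [-12, 18, 24, 0, 9, 12, 0, -36, 0, -24, 0, -18, -18, 0, 0, -9, 36, 0, 18, 0, 0, 0],
    [42, -69, -84, 0, -24, -42, 0, 138, 0, 84, 0, 48, 69, 0, 0, 24, -138, 0, -48, 0, 0, 0],
    [9, -15, -18, 0, -6, -9, 0, 30, 3, 18, 0, 12, 15, 0, 0, 6, -30, -6, -12, -3, 0, 6],
    [-3, 3, 3, 3, 0, 0, 0, -6, 0, 0, 0, 0, 0, 0, 0, 0, 0, 0, 0, 0, 0, 0],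
    [-3, 3, 3, 3, 0, 3, 0, -6, 0, -3, -3, 0, -3, 0, 0, 0, 6, 0, 0, 0, 0, 0],
    [-3, 0, 0, 0, 3, 3, 6, 0, 0, 0, 0, 0, 0, 0, 0, -9, 0, 0, 0, 0, 0, 0],
    [1, -2, -1, 0, -1, 1, 0, 2, 2, 0, 0, 1, -2, 0, 0, -1, 0, -2, 0, 2, 0, 0],
    [-1, 2, 0, 0, 1, 0, 0, 0, -2, 0, 0, 0, 0, 0, 0, 0, 0, 0, 0, 0, 0, 0],
    [7, -14, -1, 0, -7, 2, 0, 2, 14, -1, 0, 1, -4, 0, 0, -2, 2, -2, 1, 4, 0, -2],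
    [-3, 3, 3, 3, 3, 0, 0, -6, -3, 0, 0, -3, 0, -3, 0, 0, 0, 6, 0, 0, 0, 0],
    [-6, 15, -6, -3, 9, -6, 0, 9, -21, 9, 0, 3, 12, 0, 3, 3, -15, 3, -6, -6, 0, 3],
    [-1, -1, -1, 0, 1, 1, 3, 2, 1, 1, 0, 1, 1, 0, 0, -4, -2, -2, -1, -1, 0, 2],
    [3, -9, -9, 3, -3, -3, 0, 18, 9, 9, -3, 9, 9, -3, 0, 3, -18, -18, -9, -9, 3, 18]]

def inverseRow (i k : ℕ) : ℤ := (inverseRows.getD i []).getD k 0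

/-- `latticeRow i` gives the coordinates of `image i`. -/
def latticeCheck (i : ℕ) : Bool := (List.range 22).all fun k =>
  decide (latticeCoord (latticeRow i) k = imageRow i k)

/-- The `i`-th rows of the products with the inverse matrix are as they should be. -/
def inverseCheck (i : ℕ) : Bool := (List.range 22).all fun k =>
  decide (((List.range 22).map fun l => latticeRow i l * inverseRow l k).sum =
    if i = k then 3 else 0) &&
  decide (((List.range 22).map fun l => inverseRow i l * latticeRow l k).sum =
    if i = k then 3 else 0)

set_option maxRecDepth 100000 in
theorem latticeCheck_all : ((List.range 22).all latticeCheck) = true := by decide +kernel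

set_option maxRecDepth 100000 in
theorem inverseCheck_all : ((List.range 22).all inverseCheck) = true := by decide +kernel

theorem latticeCoord_latticeRow {i k : ℕ} (hi : i < 22) (hk : k < 22) :
    latticeCoord (fun l => (latticeRow i l : ℚ)) k = imageRow i k := by
  rw [← of_decide_eq_true (all_range (all_range latticeCheck_all hi) hk)]
  exact (latticeCoord_map (Int.castRingHom ℚ) (latticeRow i) hk).symm

theorem sum_latticeRow_mul_inverseRow {i k : ℕ} (hi : i < 22) (hk : k < 22) :
    ∑ l ∈ Finset.range 22, (latticeRow i l : ℚ) * inverseRow l k = if i = k then 3 else 0 := by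
  have h := all_range (all_range inverseCheck_all hi) hk
  rw [Bool.and_eq_true] at h
  have h := of_decide_eq_true h.1
  rw [sum_map_range] at h
  have h' := congrArg (Int.cast : ℤ → ℚ) h
  push_cast at h'
  exact h'

theorem sum_inverseRow_mul_latticeRow {i k : ℕ} (hi : i < 22) (hk : k < 22) :
    ∑ l ∈ Finset.range 22, (inverseRow i l : ℚ) * latticeRow l k = if i = k then 3 else 0 := by
  have h := all_range (all_range inverseCheck_all hi) hk
  rw [Bool.and_eq_true] at h
  have h := of_decide_eq_true h.2
  rw [sum_map_range] at h
  have h' := congrArg (Int.cast : ℤ → ℚ) h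
  push_cast at h'
  exact h'

theorem sum_smul_image (c : ℕ → ℚ) : ∑ i ∈ Finset.range 22, c i • image i =
    ofCoord (latticeCoord fun k => ∑ i ∈ Finset.range 22, c i * latticeRow i k) := by
  simp only [image, ← ofCoord_smul, ← ofCoord_sum]
  refine ofCoord_congr fun k hk => ?_
  rw [latticeCoord_sum _ _ _ hk]
  refine Finset.sum_congr rfl fun i hi => ?_
  rw [latticeCoord_latticeRow (Finset.mem_range.1 hi) hk, smul_eq_mul]

theorem eq_zero_of_sum_smul_image {c : ℕ → ℚ} (h : ∑ i ∈ Finset.range 22, c i • image i = 0)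
    {j : ℕ} (hj : j < 22) : c j = 0 := by
  rw [sum_smul_image] at h
  have h0 : ∀ k < 22, ∑ i ∈ Finset.range 22, c i * (latticeRow i k : ℚ) = 0 := fun k hk => by
    refine eq_zero_of_latticeCoord_eq_zero (p := fun k => ∑ i ∈ Finset.range 22,
      c i * (latticeRow i k : ℚ)) (fun k hk => ?_) hk
    rw [← coord_ofCoord (latticeCoord _) hk, h]
    interval_cases k <;> rfl
  have h3 : ∑ k ∈ Finset.range 22, (∑ i ∈ Finset.range 22, c i * (latticeRow i k : ℚ)) *
      inverseRow k j = 0 :=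
    Finset.sum_eq_zero fun k hk => by rw [h0 k (Finset.mem_range.1 hk), zero_mul]
  simp only [Finset.sum_mul, mul_assoc] at h3
  rw [Finset.sum_comm] at h3
  simp only [← Finset.mul_sum] at h3
  have h4 : ∑ i ∈ Finset.range 22, c i * (if i = j then 3 else 0) = 0 := by
    refine Eq.trans ?_ h3
    refine Finset.sum_congr rfl fun i hi => ?_
    rw [sum_latticeRow_mul_inverseRow (Finset.mem_range.1 hi) hj]
  simpa [hj] using h4

theorem exists_sum_smul_image (p : ℕ → Z2) : ∃ c : ℕ → Z2,
    ofCoord (latticeCoord fun k => (p k : ℚ)) = ∑ i ∈ Finset.range 22, c i • image i := by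
  have h3 : (1 / 3 : ℚ) ∈ Z2 := by
    change Odd (1 / 3 : ℚ).den
    norm_num
  refine ⟨fun i => ⟨1 / 3, h3⟩ * ∑ l ∈ Finset.range 22, p l * (inverseRow l i : Z2), ?_⟩
  refine (Eq.trans ?_ (sum_smul_image fun i =>
    1 / 3 * ∑ l ∈ Finset.range 22, (p l : ℚ) * inverseRow l i).symm).trans ?_
  · refine ofCoord_congr fun k hk => latticeCoord_congr (fun k hk => ?_) hk
    simp only [mul_assoc, Finset.sum_mul, ← Finset.mul_sum]
    rw [Finset.sum_comm]
    simp only [← Finset.mul_sum]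
    have h : ∀ l ∈ Finset.range 22, (p l : ℚ) * ∑ i ∈ Finset.range 22,
        (inverseRow l i : ℚ) * latticeRow i k = p l * if l = k then 3 else 0 := fun l hl => by
      rw [sum_inverseRow_mul_latticeRow (Finset.mem_range.1 hl) hk]
    rw [Finset.sum_congr rfl h]
    simp [hk]
    ring
  · refine Finset.sum_congr rfl fun i _ => ?_
    have : ((⟨1 / 3, h3⟩ * ∑ l ∈ Finset.range 22, p l * (inverseRow l i : Z2) : Z2) : ℚ) =
        1 / 3 * ∑ l ∈ Finset.range 22, (p l : ℚ) * inverseRow l i := by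
      push_cast
      rfl
    rw [← this]
    rfl

/-! ## The isomorphisms -/

theorem Z2_smul (c : Z2) (m : A ℚ) : c • m = (c : ℚ) • m := rfl

theorem map_ofCoord (f : ℕ → Z2) : A.map Z2 ℚ (ofCoord f) = ofCoord fun k => (f k : ℚ) := rfl

theorem coord_map (m : A Z2) {k : ℕ} (hk : k < 22) :
    coord (A.map Z2 ℚ m) k = ((coord m k : Z2) : ℚ) := by
  interval_cases k <;> rfl

theorem ofCoord_mem_congruenceAlgebra (p : ℕ → Z2) :
    ofCoord (latticeCoord p) ∈ congruenceAlgebra := by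
  have h2 (c : Z2) : (2 : Z2) ∣ 2 * c := ⟨c, rfl⟩
  have h4 (c : Z2) : (4 : Z2) ∣ 4 * c := ⟨c, rfl⟩
  refine ⟨⟨?_, ?_, h4 _⟩, fun i => ?_, h2 _, fun i => ?_, h2 _⟩
  · change (8 : Z2) ∣ 2 * (p 19 + 2 * p 20 + 4 * p 14) - 2 * p 19 - 4 * p 20
    exact ⟨p 14, by ring⟩
  · exact dvd_sub (h4 _) (h4 _)
  · fin_cases i <;> exact h4 _
  · fin_cases i <;> exact h2 _

theorem exists_eq_ofCoord_of_mem {m : A Z2} (hm : m ∈ congruenceAlgebra) :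
    ∃ p : ℕ → Z2, m = ofCoord (latticeCoord p) := by
  obtain ⟨⟨⟨r, hr⟩, ⟨q', hq'⟩, ⟨q, hq⟩⟩, hx, ⟨y, hy⟩, ht, ⟨v, hv⟩⟩ := hm
  choose x hx using hx
  choose t ht using ht
  let p : ℕ → Z2 := fun
    | 9 => t 0 | 10 => t 1 | 11 => t 2 | 13 => v | 14 => r
    | 15 => x 0 | 16 => x 1 | 17 => x 2 | 18 => y | 20 => q' + q | 21 => q
    | k => coord m k
  have h20 : m.z.snd.1 = 4 * (q' + q) := by linear_combination hq' + hq
  have h14 : m.w = m.z.fst + 2 * (q' + q) + 4 * r := by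
    have h2 : (2 : Z2) * m.w = 2 * (m.z.fst + 2 * (q' + q) + 4 * r) := by
      linear_combination hr + h20
    exact mul_left_cancel₀ two_ne_zero h2
  refine ⟨p, coord_injective fun k hk => ?_⟩
  rw [coord_ofCoord _ hk]
  interval_cases k
  all_goals first
    | rfl
    | exact ht _
    | exact hx _
    | exact hv
    | exact hy
    | exact h14
    | exact h20
    | exact hq

theorem mem_map_congruenceAlgebra {m : A ℚ} :
    m ∈ congruenceAlgebra.map (A.map Z2 ℚ) ↔
      ∃ p : ℕ → Z2, m = ofCoord (latticeCoord fun k => (p k : ℚ)) := by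
  have hmap (p : ℕ → Z2) : A.map Z2 ℚ (ofCoord (latticeCoord p)) =
      ofCoord (latticeCoord fun k => (p k : ℚ)) := by
    rw [map_ofCoord]
    exact ofCoord_congr fun k hk => latticeCoord_map Z2.subtype p hk
  constructor
  · rintro ⟨m, hm, rfl⟩
    obtain ⟨p, rfl⟩ := exists_eq_ofCoord_of_mem hm
    exact ⟨p, hmap p⟩
  · rintro ⟨p, rfl⟩
    exact ⟨_, ofCoord_mem_congruenceAlgebra p, hmap p⟩

theorem image_mem {i : ℕ} (hi : i < 22) :
    image i ∈ congruenceAlgebra.map (A.map Z2 ℚ) := by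
  refine mem_map_congruenceAlgebra.2 ⟨fun k => (latticeRow i k : Z2), ?_⟩
  refine ofCoord_congr fun k hk => ?_
  rw [← latticeCoord_latticeRow hi hk]
  exact latticeCoord_congr (fun k _ => by push_cast; rfl) hk

theorem span_image : Submodule.span Z2 (Set.range fun i : Fin 22 => image i) =
    Subalgebra.toSubmodule (congruenceAlgebra.map (A.map Z2 ℚ)) := by
  apply le_antisymm
  · rw [Submodule.span_le]
    rintro _ ⟨i, rfl⟩
    exact image_mem i.2
  · intro m hm
    obtain ⟨p, rfl⟩ := mem_map_congruenceAlgebra.1 hm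
    obtain ⟨c, hc⟩ := exists_sum_smul_image p
    rw [hc]
    exact sum_mem fun i hi => Submodule.smul_mem _ _
      (Submodule.subset_span ⟨⟨i, Finset.mem_range.1 hi⟩, rfl⟩)

theorem exists_eq_sum_repCls {R : Type} [CommRing R] (y : B R S3) :
    ∃ c : ℕ → R, y = ∑ i ∈ Finset.range 22, c i • repCls R i := by
  have hy : y ∈ Submodule.span R (Set.range fun i : Fin 22 => repCls R i) := by
    rw [span_repCls]; trivial
  obtain ⟨c, rfl⟩ := (Submodule.mem_span_range_iff_exists_fun R).1 hy
  refine ⟨fun i => if h : i < 22 then c ⟨i, h⟩ else 0, ?_⟩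
  rw [Finset.sum_range]
  simp

theorem mapB_repCls {R S : Type} [CommRing R] [CommRing S] (f : R →+* S) (i : ℕ) :
    mapB S3 f (repCls R i) = repCls S i := mapB_cls S3 f _

theorem mapB_algebraMap {R S : Type} [CommRing R] [CommRing S] (f : R →+* S) (r : R) :
    mapB S3 f (algebraMap R (B R S3) r) = algebraMap S (B S S3) (f r) := by
  change Ideal.Quotient.mk _ (MonoidAlgebra.mapRingHom (BisetClass S3) f
    (algebraMap R (FreeBiset R S3) r)) = Ideal.Quotient.mk _ (algebraMap S (FreeBiset S S3) (f r))
  congr 1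
  simp [MonoidAlgebra.coe_algebraMap]

theorem mapB_smul {R S : Type} [CommRing R] [CommRing S] (f : R →+* S) (r : R) (y : B R S3) :
    mapB S3 f (r • y) = f r • mapB S3 f y := by
  rw [Algebra.smul_def, map_mul, mapB_algebraMap, ← Algebra.smul_def]

theorem ghostMap_mapB {R : Type} [CommRing R] (f : R →+* ℚ) (c : ℕ → R) :
    ghostMap (mapB S3 f (∑ i ∈ Finset.range 22, c i • repCls R i)) =
      ∑ i ∈ Finset.range 22, f (c i) • image i := by
  rw [map_sum, map_sum]
  refine Finset.sum_congr rfl fun i hi => ?_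
  rw [mapB_smul, mapB_repCls, map_smul, ghostMap_repCls (Finset.mem_range.1 hi)]

theorem ghostMap_mapB_injective {R : Type} [CommRing R] {f : R →+* ℚ}
    (hf : Function.Injective f) : Function.Injective fun y : B R S3 => ghostMap (mapB S3 f y) := by
  have h0 : ∀ y : B R S3, ghostMap (mapB S3 f y) = 0 → y = 0 := by
    intro y hy
    obtain ⟨c, rfl⟩ := exists_eq_sum_repCls y
    rw [ghostMap_mapB] at hy
    refine Finset.sum_eq_zero fun i hi => ?_
    have hi := eq_zero_of_sum_smul_image (c := fun i => f (c i)) hy (Finset.mem_range.1 hi)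
    rw [(map_eq_zero_iff f hf).1 hi, zero_smul]
  intro y y' h
  rw [← sub_eq_zero]
  apply h0
  rw [map_sub, map_sub, sub_eq_zero]
  exact h

theorem ghostMap_injective : Function.Injective ghostMap := by
  rw [injective_iff_map_eq_zero]
  intro y hy
  obtain ⟨c, rfl⟩ := exists_eq_sum_repCls y
  rw [map_sum] at hy
  refine Finset.sum_eq_zero fun i hi => ?_
  rw [eq_zero_of_sum_smul_image (c := c) ?_ (Finset.mem_range.1 hi), zero_smul]
  rw [← hy]
  refine Finset.sum_congr rfl fun i hi => ?_
  rw [map_smul, ghostMap_repCls (Finset.mem_range.1 hi)]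

theorem ghostMap_one : ghostMap 1 = 1 := by
  have h : ghostMap (gamma 1) = 1 := by simp [ghostMap_gamma]
  have h' := ghostMap_mul 1 (gamma 1)
  rw [one_mul, h, mul_one] at h'
  exact h'.symm

/-- The isomorphism `γ`. -/
noncomputable def gammaEquiv : A ℚ ≃ₐ[ℚ] B ℚ S3 where
  toFun := gamma
  invFun y := ↑conjUnit * ghostMap y * ↑conjUnit⁻¹
  left_inv m := by simp [ghostMap_gamma, mul_assoc]
  right_inv y := ghostMap_injective (by simp [ghostMap_gamma, mul_assoc])
  map_mul' m n := ghostMap_injective (by simp [ghostMap_gamma, ghostMap_mul, mul_assoc])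
  map_add' m n := ghostMap_injective (by simp [ghostMap_gamma, mul_add, add_mul])
  commutes' r := ghostMap_injective (by
    simp [ghostMap_gamma, ghostMap_one, Algebra.algebraMap_eq_smul_one])

theorem gammaEquiv_symm_apply (z : B ℚ S3) :
    gammaEquiv.symm z = ↑conjUnit * ghostMap z * ↑conjUnit⁻¹ := rfl

theorem units_conj_conj {M : Type*} [Monoid M] (u v w : Mˣ) (z : M) :
    ↑w⁻¹ * ↑v⁻¹ * ↑u⁻¹ * (↑(u * v * w) * z * ↑(u * v * w)⁻¹) * ↑u * ↑v * ↑w = z := by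
  simp [mul_assoc]

theorem delta_gammaEquiv (y : B ℤ S3) :
    delta gammaEquiv y = ghostMap (mapB S3 (Int.castRingHom ℚ) y) := by
  rw [delta, gammaEquiv_symm_apply]
  exact units_conj_conj x₁ x₂ x₃ _

theorem localisation_range_delta : localisation (Set.range (delta gammaEquiv)) =
    Subalgebra.toSubmodule (congruenceAlgebra.map (A.map Z2 ℚ)) := by
  rw [← span_image, localisation]
  apply le_antisymm
  · rw [Submodule.span_le]
    rintro _ ⟨y, rfl⟩
    obtain ⟨c, rfl⟩ := exists_eq_sum_repCls y
    rw [delta_gammaEquiv, ghostMap_mapB]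
    refine sum_mem fun i hi => ?_
    have h := Submodule.smul_mem _ (c i : Z2) (Submodule.subset_span (R := Z2)
      (s := Set.range fun i : Fin 22 => image i) ⟨⟨i, Finset.mem_range.1 hi⟩, rfl⟩)
    rw [Z2_smul] at h
    simpa using h
  · rw [Submodule.span_le]
    rintro _ ⟨i, rfl⟩
    refine Submodule.subset_span ⟨repCls ℤ i, ?_⟩
    rw [delta_gammaEquiv, mapB_repCls, ghostMap_repCls i.2]

/-- The embedding of `B_{Z_(2)}(S₃,S₃)` into `A`. -/
noncomputable def localEmbedding : B Z2 S3 →ₐ[Z2] A ℚ where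
  toFun y := ghostMap (mapB S3 Z2.subtype y)
  map_one' := by rw [map_one, ghostMap_one]
  map_mul' x y := by rw [map_mul, ghostMap_mul]
  map_zero' := by rw [map_zero, map_zero]
  map_add' x y := by rw [map_add, map_add]
  commutes' r := by
    rw [mapB_algebraMap, Algebra.algebraMap_eq_smul_one, map_smul, ghostMap_one,
      Algebra.algebraMap_eq_smul_one, Z2_smul]
    rfl

theorem localEmbedding_apply (y : B Z2 S3) :
    localEmbedding y = ghostMap (mapB S3 Z2.subtype y) := rfl

theorem localEmbedding_injective : Function.Injective localEmbedding :=
  ghostMap_mapB_injective Subtype.val_injective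

theorem range_localEmbedding :
    localEmbedding.range = congruenceAlgebra.map (A.map Z2 ℚ) := by
  apply Subalgebra.toSubmodule_injective
  rw [← span_image]
  apply le_antisymm
  · rintro _ ⟨y, rfl⟩
    obtain ⟨c, rfl⟩ := exists_eq_sum_repCls y
    change localEmbedding _ ∈ Submodule.span Z2 (Set.range fun i : Fin 22 => image i)
    rw [localEmbedding_apply, ghostMap_mapB]
    exact sum_mem fun i hi => Submodule.smul_mem _ (c i)
      (Submodule.subset_span ⟨⟨i, Finset.mem_range.1 hi⟩, rfl⟩)
  · rw [Submodule.span_le]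
    rintro _ ⟨i, rfl⟩
    refine ⟨repCls Z2 i, (localEmbedding_apply _).trans ?_⟩
    rw [mapB_repCls, ghostMap_repCls i.2]

theorem map_injective : Function.Injective (A.map Z2 ℚ) := fun m n h =>
  coord_injective fun k hk => Subtype.val_injective (by
    rw [← coord_map m hk, ← coord_map n hk, h])

end DBurnside

theorem corollary5p3 :
    (∃ γ : DBurnside.A ℚ ≃ₐ[ℚ] DBurnside.B ℚ DBurnside.S3,
      (∀ m, γ m = DBurnside.gamma m) ∧
      DBurnside.localisation (Set.range (DBurnside.delta γ)) =
        Subalgebra.toSubmodule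
          (DBurnside.congruenceAlgebra.map (DBurnside.A.map DBurnside.Z2 ℚ))) ∧
    Nonempty (DBurnside.B DBurnside.Z2 DBurnside.S3 ≃ₐ[DBurnside.Z2]
      DBurnside.congruenceAlgebra) := by
  refine ⟨⟨DBurnside.gammaEquiv, fun _ => rfl, DBurnside.localisation_range_delta⟩, ⟨?_⟩⟩
  exact ((AlgEquiv.ofInjective _ DBurnside.localEmbedding_injective).trans
    (Subalgebra.equivOfEq _ _ DBurnside.range_localEmbedding)).trans
    (Subalgebra.equivMapOfInjective _ _ DBurnside.map_injective).symm
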